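/- Let $\frac12<H<1$, $a>0$, $\nu\in\mathbb R$, and let $B^H=(B^H_t)_{t\ge0}$ be a one-dimensional fractional Brownian motion with Hurst index $H$ on a probability space $(\Omega,\mathcal F,\mu)$, i.e. a centered continuous Gaussian process with $E[B^H_tB^H_s]=\frac12\left(t^{2H}+s^{2H}-|t-s|^{2H}\right)$ for $s,t\ge0$. Let $X^H$ be the solution of $$X^H_t=B^H_t-a\int_0^t\int_0^s(X^H_s-X^H_u)\,du\,ds+\nu t,\qquad t\ge0 .$$ Put $$h(t,s)=1-a s\,e^{as^2/2}\int_s^t e^{-au^2/2}\,du\quad(0\le s\le t),\qquad h(s)=1-a s\,e^{as^2/2}\int_s^\infty e^{-au^2/2}\,du\quad(s\ge0).$$ For deterministic $f$, the integral $\int_0^\infty f(s)\,dB^H_s\in L^2(\mu)$ is the extension of $1_{(0,t]}\mapsto B^H_t$ by linearity and by continuity for the norm $\|f\|_\phi^2=\int_0^\infty\!\int_0^\infty f(s)f(t)\,H(2H-1)|s-t|^{2H-2}\,ds\,dt$, for measurable $f$ for which this double integral converges absolutely; and $\int_0^tf(s)\,dB^H_s=\int_0^\infty 1_{(0,t]}(s)f(s)\,dB^H_s$.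 Then the integrals $\int_0^\infty h(s)\,dB^H_s$ and $\int_0^\infty h(s)\,ds$ exist, and as $t\to\infty$, $X^H_t$ converges in $L^2(\mu)$ to $$X^H_\infty=\int_0^\infty h(s)\,dB^H_s+\nu\int_0^\infty h(s)\,ds .$$ Moreover, for every $t>0$, the integral $\int_0^t\left(h(t,s)-h(s)\right)dB^H_s$ exists and $$E\left|\int_0^t\left(h(t,s)-h(s)\right)dB^H_s\right|^2\le\frac{2H}{a\,t^{2-2H}} .$$ -/

import Mathlib

open MeasureTheory ProbabilityTheory Filter Topology
open scoped NNReal ENNReal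

noncomputable section

namespace FracSelfAttracting

variable {Ω : Type*} [MeasurableSpace Ω]

/-- `B` is a fractional Brownian motion with Hurst index `H` under `μ`: a centered Gaussian process
with almost surely continuous paths and covariance
`E[B_t B_s] = (t ^ (2H) + s ^ (2H) - |t - s| ^ (2H)) / 2`. -/
structure IsFractionalBrownianMotion (H : ℝ) (B : ℝ≥0 → Ω → ℝ) (μ : Measure Ω) : Prop where
  isGaussianProcess : IsGaussianProcess B μ
  centered : ∀ t : ℝ≥0, ∫ ω, B t ω ∂μ = 0
  covariance : ∀ s t : ℝ≥0, ∫ ω, B t ω * B s ω ∂μ =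
    ((t : ℝ) ^ (2 * H) + (s : ℝ) ^ (2 * H) - |(t : ℝ) - (s : ℝ)| ^ (2 * H)) / 2
  continuous_paths : ∀ᵐ ω ∂μ, Continuous fun t : ℝ≥0 => B t ω

/-- `X` solves the equation of the one-dimensional linear self-attracting diffusion driven by `B`,
`X_t = B_t - a ∫_0^t ∫_0^s (X_s - X_u) du ds + ν t` for all `t ≥ 0`, almost surely.
The paths are asked to be locally integrable, so that the inner integral (and then, as
`s X_s - ∫_0^s X_u du` is locally integrable too, the outer one) is a genuine integral. -/
structure IsSelfAttractingDiffusion (a ν : ℝ) (B X : ℝ≥0 → Ω → ℝ) (μ : Measure Ω) : Prop where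
  locallyIntegrable_paths : ∀ᵐ ω ∂μ, ∀ t : ℝ≥0,
    IntervalIntegrable (fun s : ℝ => X s.toNNReal ω) volume 0 t
  equation : ∀ᵐ ω ∂μ, ∀ t : ℝ≥0,
    X t ω = B t ω
      - a * (∫ s in (0 : ℝ)..t, ∫ u in (0 : ℝ)..s, (X s.toNNReal ω - X u.toNNReal ω))
      + ν * t

/-- The kernel `φ(s, t) = H (2H - 1) |s - t| ^ (2H - 2)`. -/
def phi (H s t : ℝ) : ℝ := H * (2 * H - 1) * |s - t| ^ (2 * H - 2)

/-- The integrand of the double integral `∫_0^∞ ∫_0^∞ f(s) f(t) φ(s, t) ds dt`. -/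
def phiIntegrand (H : ℝ) (f : ℝ → ℝ) (z : ℝ × ℝ) : ℝ := f z.1 * f z.2 * phi H z.1 z.2

/-- Lebesgue measure on the quadrant `(0, ∞) × (0, ∞)`. -/
def quadrant : Measure (ℝ × ℝ) :=
  ((volume : Measure ℝ).restrict (Set.Ioi 0)).prod ((volume : Measure ℝ).restrict (Set.Ioi 0))

/-- The space of deterministic integrands: measurable functions `f` on `(0, ∞)` (values of `f`
elsewhere are irrelevant) with `∫_0^∞ ∫_0^∞ |f(s)| |f(t)| φ(s, t) ds dt < ∞`. -/
structure IsIntegrand (H : ℝ) (f : ℝ → ℝ) : Prop where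
  aestronglyMeasurable : AEStronglyMeasurable f ((volume : Measure ℝ).restrict (Set.Ioi 0))
  integrable : Integrable (phiIntegrand H f) quadrant

/-- The squared norm `‖f‖_φ² = ∫_0^∞ ∫_0^∞ f(s) f(t) φ(s, t) ds dt`. -/
def phiNormSq (H : ℝ) (f : ℝ → ℝ) : ℝ := ∫ z, phiIntegrand H f z ∂quadrant

/-- The step function `∑_t p(t) 1_{(0, t]}`; as `p` varies these are all the finite linear
combinations of indicators of intervals `(u, v]` with `0 ≤ u ≤ v`. -/
def stepFun (p : ℝ≥0 →₀ ℝ) (s : ℝ) : ℝ :=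
  p.sum fun t c => c * (Set.Ioc (0 : ℝ) t).indicator (fun _ => (1 : ℝ)) s

/-- The integral `∑_t p(t) B_t` of the step function `∑_t p(t) 1_{(0, t]}` against `B`
(for `B_0 = 0` the integral of `1_{(u, v]}` is thus the increment `B_v - B_u`). -/
def stepIntegral (B : ℝ≥0 → Ω → ℝ) (p : ℝ≥0 →₀ ℝ) (ω : Ω) : ℝ :=
  p.sum fun t c => c * B t ω

/-- `I` is (a version of) the stochastic integral `∫_0^∞ f(s) dB_s` of the deterministic
integrand `f` against the fractional Brownian motion `B` of Hurst index `H`: the `L²(μ)`-limit of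
the integrals of step functions which converge to `f` in the norm `‖·‖_φ`. The integral
`∫_0^t f(s) dB_s` is that of `1_{(0, t]} f`. -/
structure HasFbmIntegral (H : ℝ) (B : ℝ≥0 → Ω → ℝ) (μ : Measure Ω) (f : ℝ → ℝ) (I : Ω → ℝ) :
    Prop where
  isIntegrand : IsIntegrand H f
  memLp : MemLp I 2 μ
  exists_approx : ∃ p : ℕ → ℝ≥0 →₀ ℝ,
    Tendsto (fun n => phiNormSq H (fun s => f s - stepFun (p n) s)) atTop (𝓝 0) ∧
    Tendsto (fun n => eLpNorm (fun ω => I ω - stepIntegral B (p n) ω) 2 μ) atTop (𝓝 0)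

/-- The kernel `h(t, s) = 1 - a s e^{a s² / 2} ∫_s^t e^{-a u² / 2} du` for `s ≤ t`, and `0` for
`t < s`. -/
def hKernel (a t s : ℝ) : ℝ :=
  if s ≤ t then 1 - a * s * Real.exp (a / 2 * s ^ 2) * ∫ u in s..t, Real.exp (-(a / 2) * u ^ 2)
  else 0

/-- The limit kernel `h(s) = 1 - a s e^{a s² / 2} ∫_s^∞ e^{-a u² / 2} du`. -/
def hLim (a s : ℝ) : ℝ :=
  1 - a * s * Real.exp (a / 2 * s ^ 2) * ∫ u in Set.Ioi s, Real.exp (-(a / 2) * u ^ 2)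

end FracSelfAttracting

end

/-!
The pathwise equation is linear, and variation of constants followed by integration by parts gives
`X_t = B_t + ν t - ∫_0^t (B_s + ν s) ∂ₛh(t, s) ds` (`eq_sub_integral_derivKernel`). The right-hand
side is the almost sure limit of Riemann-Stieltjes sums (`tendsto_riemannStieltjes`), whose noise
parts are integrals of step functions that converge uniformly to `h(t, ·)` on `(0, t]`; hence
`X_t = ∫_0^t h(t, s) dB_s + ν ∫_0^t h(t, s) ds` almost surely (`exists_hasFbmIntegral_hKernel`).

The stochastic integral is handled on the functions that are integrable and bounded on `(0, ∞)`.
There the form `∬ f(s) g(t) φ(s, t) ds dt` is finite and is bounded by `L¹` and sup norms, because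
`φ` is an integrable function of `s - t` plus a bounded one (`exists_integrable_and_abs_le`). It is
positive semidefinite, as `|s - t| ^ (2H - 2)` is a multiple of
`∫ (s - r)₊ ^ (H - 3 / 2) (t - r)₊ ^ (H - 3 / 2) dr` (`phiNormSq_nonneg`), and on intervals it
reproduces the covariance of `B` (`phiInner_indicator`). So the integral is an isometry
(`HasFbmIntegral.integral_sq`), and it exists by completeness of `L²`.

It remains to compare kernels. With `Q(t) = ∫_t^∞ e^{-a u² / 2} du`, the difference
`h(t, s) - h(s) = a s e^{a s² / 2} Q(t)` lies in `[0, 1]` for `0 ≤ s ≤ t`, and its integral over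
`(0, t]` is at most `e^{a t² / 2} Q(t) ≤ 1 / (a t)`. The kernel `h` is nonnegative, at most `1`, and
minus the derivative of `e^{a s² / 2} Q(s)`, which tends to `0`, so it is integrable. Hence the
kernels converge in `L¹` while staying bounded, so also in `‖·‖_φ`. For `f` supported in `(0, t]`
with values in `[0, 1]` one has
`‖f‖_φ² ≤ ∬ f(s) 1_{(0, t]}(u) φ(s, u) du ds ≤ 2 H t ^ (2H - 1) ∫ f`
(`phiNormSq_le_of_support`), which gives the rate.
-/

/-! ### The kernel and its bilinear form -/

namespace FracSelfAttracting

variable {H : ℝ} {f g w : ℝ → ℝ}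

lemma phi_nonneg (hH : 1 / 2 < H) (s t : ℝ) : 0 ≤ phi H s t := by
  have h1 : 0 ≤ H * (2 * H - 1) := mul_nonneg (by linarith) (by linarith)
  exact mul_nonneg h1 (Real.rpow_nonneg (abs_nonneg _) _)

lemma phi_comm (H s t : ℝ) : phi H s t = phi H t s := by
  rw [phi, phi, abs_sub_comm]

lemma measurable_phi (H : ℝ) : Measurable fun z : ℝ × ℝ => phi H z.1 z.2 := by
  unfold phi
  fun_prop

lemma intervalIntegrable_abs_rpow {p : ℝ} (hp : -1 < p) (a b : ℝ) :
    IntervalIntegrable (fun x : ℝ => |x| ^ p) volume a b := by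
  have pos : ∀ c : ℝ, 0 ≤ c → IntervalIntegrable (fun x : ℝ => |x| ^ p) volume 0 c := by
    intro c hc
    refine (intervalIntegral.intervalIntegrable_rpow' hp (a := 0) (b := c)).congr ?_
    intro x hx
    rw [Set.uIoc_of_le hc] at hx
    simp only [abs_of_pos hx.1]
  have all : ∀ c : ℝ, IntervalIntegrable (fun x : ℝ => |x| ^ p) volume 0 c := by
    intro c
    rcases le_total 0 c with hc | hc
    · exact pos c hc
    · have h := pos (-c) (by linarith)
      rw [IntervalIntegrable.iff_comp_neg] at h
      simpa using h
  exact (all a).symm.trans (all b)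

lemma integral_zero_abs_rpow {p : ℝ} (hp : -1 < p) (c : ℝ) :
    ∫ x in (0 : ℝ)..c, |x| ^ p = |c| ^ p * c / (p + 1) := by
  have pos : ∀ c : ℝ, 0 ≤ c → ∫ x in (0 : ℝ)..c, |x| ^ p = |c| ^ p * c / (p + 1) := by
    intro c hc
    have h1 : ∫ x in (0 : ℝ)..c, |x| ^ p = ∫ x in (0 : ℝ)..c, x ^ p := by
      refine intervalIntegral.integral_congr fun x hx => ?_
      rw [Set.uIcc_of_le hc] at hx
      simp only [abs_of_nonneg hx.1]
    rw [h1, integral_rpow (Or.inl hp), Real.zero_rpow (by linarith), abs_of_nonneg hc]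
    rcases hc.eq_or_lt with rfl | hc
    · simp [Real.zero_rpow (show p + 1 ≠ 0 by linarith)]
    · rw [Real.rpow_add_one hc.ne']; ring
  rcases le_total 0 c with hc | hc
  · exact pos c hc
  · have h := pos (-c) (by linarith)
    have h2 : ∫ x in (0 : ℝ)..(-c), |x| ^ p = -∫ x in (0 : ℝ)..c, |x| ^ p := by
      have := intervalIntegral.integral_comp_neg (a := 0) (b := c) (fun x : ℝ => |x| ^ p)
      simp only [abs_neg, neg_zero] at this
      rw [this, intervalIntegral.integral_symm]
    rw [h2, abs_neg] at h
    linear_combination -h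

/-- The kernel is at most the sum of an integrable function of the difference, which carries the
singularity at the diagonal, and of a constant. -/
lemma exists_phi_le (hH : 1 / 2 < H) (hH1 : H < 1) :
    ∃ k : ℝ → ℝ, Integrable k ∧ (∀ x, 0 ≤ k x) ∧ ∀ s t, phi H s t ≤ k (t - s) + 1 := by
  have hc0 : 0 ≤ H * (2 * H - 1) := mul_nonneg (by linarith) (by linarith)
  refine ⟨(Set.Ioc (-1) 1).indicator fun x => H * (2 * H - 1) * |x| ^ (2 * H - 2), ?_, ?_, ?_⟩
  · rw [integrable_indicator_iff measurableSet_Ioc]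
    refine Integrable.const_mul ?_ _
    have := intervalIntegrable_abs_rpow (show -1 < 2 * H - 2 by linarith) (-1) 1
    rwa [intervalIntegrable_iff_integrableOn_Ioc_of_le (by norm_num)] at this
  · intro x
    exact Set.indicator_nonneg (fun y _ => mul_nonneg hc0 (Real.rpow_nonneg (abs_nonneg _) _)) x
  · intro s t
    rw [phi_comm]
    by_cases h : t - s ∈ Set.Ioc (-1 : ℝ) 1
    · rw [Set.indicator_of_mem h, phi]; linarith
    · rw [Set.indicator_of_notMem h, phi, zero_add]
      have h1 : 1 ≤ |t - s| := by
        by_contra hlt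
        rw [not_le, abs_lt] at hlt
        exact h ⟨hlt.1, hlt.2.le⟩
      have h2 : |t - s| ^ (2 * H - 2) ≤ 1 :=
        Real.rpow_le_one_of_one_le_of_nonpos h1 (by linarith)
      have h3 : H * (2 * H - 1) ≤ 1 := by nlinarith
      have h4 : 0 ≤ |t - s| ^ (2 * H - 2) := Real.rpow_nonneg (abs_nonneg _) _
      nlinarith

/-- Functions that are integrable and bounded on `(0, ∞)`. They are integrands, they are stable
under linear combinations, and they contain the step functions and the kernels `h`. -/
structure IsBddIntegrable (f : ℝ → ℝ) : Prop where
  integrableOn : IntegrableOn f (Set.Ioi 0)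
  bounded : ∃ M : ℝ, ∀ s : ℝ, 0 < s → |f s| ≤ M

/-- The bilinear form `∫_0^∞ ∫_0^∞ f(s) g(t) φ(s, t) ds dt` whose quadratic form is `‖·‖_φ²`. -/
noncomputable def phiInner (H : ℝ) (f g : ℝ → ℝ) : ℝ := ∫ z, f z.1 * g z.2 * phi H z.1 z.2 ∂quadrant

lemma phiNormSq_eq (H : ℝ) (f : ℝ → ℝ) : phiNormSq H f = phiInner H f f := rfl

lemma ae_quadrant_pos : ∀ᵐ z ∂quadrant, 0 < z.1 ∧ 0 < z.2 := by
  rw [quadrant, Measure.prod_restrict]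
  filter_upwards [ae_restrict_mem (measurableSet_Ioi.prod measurableSet_Ioi)] with z hz
  exact ⟨hz.1, hz.2⟩

/-- The form is controlled by `L¹` and sup norms, as the kernel is integrable near the diagonal and
bounded away from it. -/
lemma exists_integrable_and_abs_le (hH : 1 / 2 < H) (hH1 : H < 1) :
    ∃ C : ℝ, 0 ≤ C ∧ ∀ (u v : ℝ → ℝ) (M : ℝ), IntegrableOn u (Set.Ioi 0) →
      IntegrableOn v (Set.Ioi 0) → (∀ s, 0 < s → |v s| ≤ M) →
      Integrable (fun z : ℝ × ℝ => u z.1 * v z.2 * phi H z.1 z.2) quadrant ∧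
      |phiInner H u v| ≤ C * (∫ s in Set.Ioi (0 : ℝ), |u s|)
        * ((∫ s in Set.Ioi (0 : ℝ), |v s|) + M) := by
  obtain ⟨k, hk, hk0, hle⟩ := exists_phi_le hH hH1
  have hK0 : 0 ≤ ∫ x, k x := integral_nonneg hk0
  refine ⟨1 + ∫ x, k x, by positivity, fun u v M hu hv hM => ?_⟩
  have hM0 : 0 ≤ M := (abs_nonneg _).trans (hM 1 one_pos)
  have hprod : Integrable (fun z : ℝ × ℝ => |u z.1| * |v z.2|) quadrant :=
    Integrable.mul_prod hu.abs hv.abs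
  have hfull : Integrable (fun z : ℝ × ℝ => |u z.1| * k (z.2 - z.1))
      ((volume.restrict (Set.Ioi (0 : ℝ))).prod volume) := by
    have := (Integrable.convolution_integrand (ContinuousLinearMap.mul ℝ ℝ)
      (μ := (volume : Measure ℝ)) hu.abs hk).swap
    exact this
  have hquad : quadrant =
      ((volume.restrict (Set.Ioi (0 : ℝ))).prod volume).restrict (Set.univ ×ˢ Set.Ioi 0) := by
    rw [← Measure.prod_restrict, Measure.restrict_univ, quadrant]
  have hconv : Integrable (fun z : ℝ × ℝ => |u z.1| * k (z.2 - z.1)) quadrant := by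
    rw [hquad]; exact hfull.restrict
  have hconv_le : ∫ z, |u z.1| * k (z.2 - z.1) ∂quadrant
      ≤ (∫ s in Set.Ioi (0 : ℝ), |u s|) * ∫ x, k x := by
    rw [hquad]
    refine (setIntegral_le_integral hfull
      (Eventually.of_forall fun z => mul_nonneg (abs_nonneg _) (hk0 _))).trans_eq ?_
    rw [integral_prod _ hfull, ← integral_mul_const]
    refine integral_congr_ae (Eventually.of_forall fun s => ?_)
    simp only [integral_const_mul]
    rw [integral_sub_right_eq_self k s]
  have hpt : ∀ᵐ z ∂quadrant, ‖u z.1 * v z.2 * phi H z.1 z.2‖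
      ≤ |u z.1| * |v z.2| + M * (|u z.1| * k (z.2 - z.1)) := by
    filter_upwards [ae_quadrant_pos] with z hz
    rw [Real.norm_eq_abs, abs_mul, abs_mul, abs_of_nonneg (phi_nonneg hH _ _)]
    have h1 := hle z.1 z.2
    have h2 := hM _ hz.2
    calc |u z.1| * |v z.2| * phi H z.1 z.2
        ≤ |u z.1| * |v z.2| * (k (z.2 - z.1) + 1) := by gcongr
      _ = |u z.1| * |v z.2| + |v z.2| * (|u z.1| * k (z.2 - z.1)) := by ring
      _ ≤ _ := by
        have := mul_nonneg (abs_nonneg (u z.1)) (hk0 (z.2 - z.1))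
        gcongr
  have hbd := hprod.add (hconv.const_mul M)
  have hmeas : AEStronglyMeasurable (fun z : ℝ × ℝ => u z.1 * v z.2 * phi H z.1 z.2) quadrant :=
    (hu.aestronglyMeasurable.comp_fst.mul hv.aestronglyMeasurable.comp_snd).mul
      (measurable_phi H).aestronglyMeasurable
  refine ⟨hbd.mono' hmeas hpt, ?_⟩
  have hprod_eq : ∫ z, |u z.1| * |v z.2| ∂quadrant
      = (∫ s in Set.Ioi (0 : ℝ), |u s|) * ∫ s in Set.Ioi (0 : ℝ), |v s| :=
    integral_prod_mul (fun s => |u s|) fun s => |v s|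
  have hU0 : 0 ≤ ∫ s in Set.Ioi (0 : ℝ), |u s| := integral_nonneg fun s => abs_nonneg _
  have hV0 : 0 ≤ ∫ s in Set.Ioi (0 : ℝ), |v s| := integral_nonneg fun s => abs_nonneg _
  have h := norm_integral_le_of_norm_le hbd hpt
  simp only [Pi.add_apply] at h
  rw [integral_add hprod (hconv.const_mul M), integral_const_mul, hprod_eq] at h
  rw [phiInner, ← Real.norm_eq_abs]
  have h5 := mul_le_mul_of_nonneg_left hconv_le hM0
  have h6 := mul_nonneg hU0 hM0
  have h7 := mul_nonneg hK0 (mul_nonneg hU0 hV0)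
  nlinarith

namespace IsBddIntegrable

lemma add (hf : IsBddIntegrable f) (hg : IsBddIntegrable g) :
    IsBddIntegrable fun s => f s + g s := by
  obtain ⟨M, hM⟩ := hf.bounded
  obtain ⟨N, hN⟩ := hg.bounded
  exact ⟨hf.1.add hg.1, M + N, fun s hs =>
    (abs_add_le _ _).trans (add_le_add (hM s hs) (hN s hs))⟩

lemma const_mul (hf : IsBddIntegrable f) (c : ℝ) : IsBddIntegrable fun s => c * f s := by
  obtain ⟨M, hM⟩ := hf.bounded
  refine ⟨hf.1.const_mul c, |c| * M, fun s hs => ?_⟩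
  rw [abs_mul]
  exact mul_le_mul_of_nonneg_left (hM s hs) (abs_nonneg c)

lemma sub (hf : IsBddIntegrable f) (hg : IsBddIntegrable g) :
    IsBddIntegrable fun s => f s - g s := by
  have := hf.add (hg.const_mul (-1))
  simpa [sub_eq_add_neg] using this

lemma integrable_mul_phi (hH : 1 / 2 < H) (hH1 : H < 1) (hf : IsBddIntegrable f)
    (hg : IsBddIntegrable g) :
    Integrable (fun z : ℝ × ℝ => f z.1 * g z.2 * phi H z.1 z.2) quadrant := by
  obtain ⟨C, -, hC⟩ := exists_integrable_and_abs_le hH hH1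
  obtain ⟨M, hM⟩ := hg.bounded
  exact (hC f g M hf.1 hg.1 hM).1

lemma isIntegrand (hH : 1 / 2 < H) (hH1 : H < 1) (hf : IsBddIntegrable f) : IsIntegrand H f :=
  ⟨hf.1.aestronglyMeasurable, hf.integrable_mul_phi hH hH1 hf⟩

end IsBddIntegrable

lemma isBddIntegrable_indicator_Ioc (t : ℝ) :
    IsBddIntegrable ((Set.Ioc (0 : ℝ) t).indicator fun _ => (1 : ℝ)) := by
  refine ⟨?_, 1, fun s _ => ?_⟩
  · refine Integrable.integrableOn ?_
    rw [integrable_indicator_iff measurableSet_Ioc]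
    exact integrableOn_const (by simp)
  · by_cases h : s ∈ Set.Ioc (0 : ℝ) t <;> simp [h]

lemma phiInner_comm (H : ℝ) (f g : ℝ → ℝ) : phiInner H f g = phiInner H g f := by
  rw [phiInner, quadrant, ← integral_prod_swap]
  refine integral_congr_ae (Eventually.of_forall fun z => ?_)
  simp only [Prod.fst_swap, Prod.snd_swap]
  rw [phi_comm]; ring

lemma phiInner_add_left (hH : 1 / 2 < H) (hH1 : H < 1) (hf : IsBddIntegrable f)
    (hg : IsBddIntegrable g) (hw : IsBddIntegrable w) :
    phiInner H (fun s => f s + g s) w = phiInner H f w + phiInner H g w := by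
  rw [phiInner, phiInner, phiInner, ← integral_add (hf.integrable_mul_phi hH hH1 hw)
    (hg.integrable_mul_phi hH hH1 hw)]
  exact integral_congr_ae (Eventually.of_forall fun z => by ring)

lemma phiInner_const_mul_left (H c : ℝ) (f w : ℝ → ℝ) :
    phiInner H (fun s => c * f s) w = c * phiInner H f w := by
  rw [phiInner, phiInner, ← integral_const_mul]
  exact integral_congr_ae (Eventually.of_forall fun z => by ring)

/-- The quadratic form along a line. -/
lemma phiNormSq_add_const_mul (hH : 1 / 2 < H) (hH1 : H < 1) (hf : IsBddIntegrable f)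
    (hg : IsBddIntegrable g) (c : ℝ) :
    phiNormSq H (fun s => f s + c * g s)
      = phiNormSq H f + 2 * c * phiInner H f g + c ^ 2 * phiNormSq H g := by
  have hcg := hg.const_mul c
  simp only [phiNormSq_eq]
  rw [phiInner_add_left hH hH1 hf hcg (hf.add hcg), phiInner_comm H f,
    phiInner_comm H fun s => c * g s, phiInner_add_left hH hH1 hf hcg hf,
    phiInner_add_left hH hH1 hf hcg hcg, phiInner_comm H f fun s => c * g s]
  simp only [phiInner_const_mul_left]
  rw [phiInner_comm H g fun s => c * g s, phiInner_const_mul_left, phiInner_comm H g f]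
  ring

/-- A kernel of the form `k(s, t) = ∫ K(s, w) K(t, w) dν(w)` is positive semidefinite. -/
lemma integral_mul_kernel_nonneg {S W : Type*} [MeasurableSpace S] [MeasurableSpace W]
    {m : Measure S} [SFinite m] {ν : Measure W} [SFinite ν] {K : S → W → ℝ} {k : S × S → ℝ}
    {f : S → ℝ} (hf : AEStronglyMeasurable f m) (hK : Measurable (Function.uncurry K))
    (hK0 : ∀ s w, 0 ≤ K s w)
    (hint : ∀ᵐ z ∂m.prod m, Integrable (fun w => K z.1 w * K z.2 w) ν)
    (hk : ∀ᵐ z ∂m.prod m, ∫ w, K z.1 w * K z.2 w ∂ν = k z)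
    (hfk : Integrable (fun z => f z.1 * f z.2 * k z) (m.prod m)) :
    0 ≤ ∫ z, f z.1 * f z.2 * k z ∂m.prod m := by
  have hmeas : AEStronglyMeasurable
      (fun q : (S × S) × W => f q.1.1 * f q.1.2 * (K q.1.1 q.2 * K q.1.2 q.2))
      ((m.prod m).prod ν) := by
    refine AEStronglyMeasurable.mul (hf.comp_fst.mul hf.comp_snd).comp_fst ?_
    refine Measurable.aestronglyMeasurable ?_
    have h1 : Measurable fun q : (S × S) × W => K q.1.1 q.2 :=
      hK.comp (measurable_fst.fst.prodMk measurable_snd)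
    have h2 : Measurable fun q : (S × S) × W => K q.1.2 q.2 :=
      hK.comp (measurable_fst.snd.prodMk measurable_snd)
    exact h1.mul h2
  have hI : Integrable
      (fun q : (S × S) × W => f q.1.1 * f q.1.2 * (K q.1.1 q.2 * K q.1.2 q.2))
      ((m.prod m).prod ν) := by
    rw [integrable_prod_iff hmeas]
    refine ⟨?_, ?_⟩
    · filter_upwards [hint] with z hz using hz.const_mul _
    · refine hfk.norm.congr ?_
      filter_upwards [hk] with z hz
      simp only [norm_mul, Real.norm_eq_abs, integral_const_mul, abs_of_nonneg (hK0 _ _), hz]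
      rw [abs_of_nonneg (a := k z)]
      rw [← hz]
      exact integral_nonneg fun w => mul_nonneg (hK0 _ _) (hK0 _ _)
  have h1 : ∫ z, f z.1 * f z.2 * k z ∂m.prod m
      = ∫ z, ∫ w, f z.1 * f z.2 * (K z.1 w * K z.2 w) ∂ν ∂m.prod m := by
    refine integral_congr_ae ?_
    filter_upwards [hk] with z hz
    rw [integral_const_mul, hz]
  rw [h1, integral_integral_swap hI]
  refine integral_nonneg fun w => ?_
  have h2 : ∫ z, f z.1 * f z.2 * (K z.1 w * K z.2 w) ∂m.prod m
      = (∫ s, f s * K s w ∂m) * ∫ s, f s * K s w ∂m := by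
    rw [← integral_prod_mul]
    exact integral_congr_ae (Eventually.of_forall fun z => by ring)
  rw [h2]
  exact mul_self_nonneg _

/-- The constant in `∫ (s - r)₊ ^ (H - 3 / 2) (t - r)₊ ^ (H - 3 / 2) dr = c |s - t| ^ (2H - 2)`. -/
noncomputable def rootConst (H : ℝ) : ℝ :=
  ∫ x in Set.Ioi (0 : ℝ), x ^ (H - 3 / 2) * (x + 1) ^ (H - 3 / 2)

lemma integrableOn_rootConst (hH : 1 / 2 < H) (hH1 : H < 1) :
    IntegrableOn (fun x : ℝ => x ^ (H - 3 / 2) * (x + 1) ^ (H - 3 / 2)) (Set.Ioi 0) := by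
  have hm : Measurable fun x : ℝ => x ^ (H - 3 / 2) * (x + 1) ^ (H - 3 / 2) := by fun_prop
  rw [← Set.Ioc_union_Ioi_eq_Ioi (zero_le_one' ℝ)]
  refine IntegrableOn.union ?_ ?_
  · have h := intervalIntegral.intervalIntegrable_rpow' (show -1 < H - 3 / 2 by linarith)
      (a := 0) (b := 1)
    rw [intervalIntegrable_iff_integrableOn_Ioc_of_le zero_le_one] at h
    refine Integrable.mono' h hm.aestronglyMeasurable ?_
    filter_upwards [ae_restrict_mem measurableSet_Ioc] with x hx
    have h0 : 0 ≤ x ^ (H - 3 / 2) := Real.rpow_nonneg hx.1.le _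
    have h1 : 0 ≤ (x + 1) ^ (H - 3 / 2) := Real.rpow_nonneg (by linarith [hx.1]) _
    have h2 : (x + 1) ^ (H - 3 / 2) ≤ 1 :=
      Real.rpow_le_one_of_one_le_of_nonpos (by linarith [hx.1]) (by linarith)
    rw [Real.norm_eq_abs, abs_of_nonneg (mul_nonneg h0 h1)]
    nlinarith
  · refine Integrable.mono' (integrableOn_Ioi_rpow_of_lt (show 2 * H - 3 < -1 by linarith)
      one_pos) hm.aestronglyMeasurable ?_
    filter_upwards [ae_restrict_mem measurableSet_Ioi] with x hx
    have hx1 : (1 : ℝ) < x := hx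
    have h0 : 0 ≤ x ^ (H - 3 / 2) := Real.rpow_nonneg (by linarith) _
    have h1 : 0 ≤ (x + 1) ^ (H - 3 / 2) := Real.rpow_nonneg (by linarith) _
    have h2 : (x + 1) ^ (H - 3 / 2) ≤ x ^ (H - 3 / 2) :=
      Real.rpow_le_rpow_of_nonpos (by linarith) (by linarith) (by linarith)
    have h3 : x ^ (2 * H - 3) = x ^ (H - 3 / 2) * x ^ (H - 3 / 2) := by
      rw [← Real.rpow_add (by linarith)]; ring_nf
    rw [Real.norm_eq_abs, abs_of_nonneg (mul_nonneg h0 h1), h3]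
    gcongr

lemma rootConst_pos (hH : 1 / 2 < H) (hH1 : H < 1) : 0 < rootConst H := by
  rw [rootConst, setIntegral_pos_iff_support_of_nonneg_ae]
  · refine lt_of_lt_of_le ?_ (measure_mono (s := Set.Ioi (0 : ℝ)) fun x hx => ⟨?_, hx⟩)
    · simp
    · have hx' : (0 : ℝ) < x := hx
      exact (mul_pos (Real.rpow_pos_of_pos hx' _)
        (Real.rpow_pos_of_pos (by linarith) _)).ne'
  · filter_upwards [ae_restrict_mem measurableSet_Ioi] with x hx
    have hx' : (0 : ℝ) < x := hx
    exact mul_nonneg (Real.rpow_nonneg hx'.le _) (Real.rpow_nonneg (by linarith) _)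
  · exact integrableOn_rootConst hH hH1

/-- The truncated power `(s - r)₊ ^ (H - 3 / 2)`, a square root of the kernel up to a constant. -/
noncomputable def rootKernel (H s r : ℝ) : ℝ := if r < s then (s - r) ^ (H - 3 / 2) else 0

lemma rootKernel_mul_of_lt (hH : 1 / 2 < H) (hH1 : H < 1) {s t : ℝ} (hst : s < t) :
    Integrable (fun r => rootKernel H s r * rootKernel H t r) ∧
    ∫ r, rootKernel H s r * rootKernel H t r = rootConst H * |s - t| ^ (2 * H - 2) := by
  have hd : 0 < t - s := by linarith
  set d := t - s with hd_def
  set F : ℝ → ℝ := fun x => x ^ (H - 3 / 2) * (x + 1) ^ (H - 3 / 2) with hF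
  set G : ℝ → ℝ := (Set.Ioi 0).indicator fun x => d ^ (2 * H - 3) * F (d⁻¹ * x) with hG
  have hG_eq : ∀ r, rootKernel H s r * rootKernel H t r = G (s - r) := by
    intro r
    by_cases hr : r < s
    · have h0 : 0 < s - r := by linarith
      have h1 : (s - r) ∈ Set.Ioi (0 : ℝ) := h0
      rw [hG, Set.indicator_of_mem h1, rootKernel, rootKernel, if_pos hr,
        if_pos (by linarith : r < t)]
      have e1 : s - r = d * (d⁻¹ * (s - r)) := by field_simp
      have e2 : t - r = d * (d⁻¹ * (s - r) + 1) := by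
        rw [mul_add, ← e1, hd_def]; ring
      have hp : 0 < d⁻¹ * (s - r) := by positivity
      have e3 : d ^ (2 * H - 3) = d ^ (H - 3 / 2) * d ^ (H - 3 / 2) := by
        rw [← Real.rpow_add hd]; ring_nf
      rw [e2, e3]
      nth_rw 1 [e1]
      rw [Real.mul_rpow hd.le hp.le, Real.mul_rpow hd.le (by linarith), hF]
      ring
    · have h1 : (s - r) ∉ Set.Ioi (0 : ℝ) := by simpa using hr
      rw [hG, Set.indicator_of_notMem h1, rootKernel, if_neg hr, zero_mul]
  have hGi : Integrable G := by
    rw [hG, integrable_indicator_iff measurableSet_Ioi]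
    refine Integrable.const_mul ?_ _
    have := (integrableOn_Ioi_comp_mul_left_iff F 0 (inv_pos.2 hd)).2
      (by rw [mul_zero]; exact integrableOn_rootConst hH hH1)
    exact this
  have hGv : ∫ x, G x = rootConst H * |s - t| ^ (2 * H - 2) := by
    rw [hG, integral_indicator measurableSet_Ioi, integral_const_mul,
      integral_comp_mul_left_Ioi F 0 (inv_pos.2 hd), mul_zero, inv_inv, smul_eq_mul,
      abs_sub_comm, abs_of_pos hd]
    have e : d ^ (2 * H - 2) = d ^ (2 * H - 3) * d := by
      rw [← Real.rpow_add_one hd.ne']; ring_nf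
    rw [e, rootConst]; ring
  simp only [hG_eq]
  exact ⟨hGi.comp_sub_left s, by rw [integral_sub_left_eq_self G volume s, hGv]⟩

lemma rootKernel_mul (hH : 1 / 2 < H) (hH1 : H < 1) {s t : ℝ} (hst : s ≠ t) :
    Integrable (fun r => rootKernel H s r * rootKernel H t r) ∧
    ∫ r, rootKernel H s r * rootKernel H t r = rootConst H * |s - t| ^ (2 * H - 2) := by
  rcases hst.lt_or_gt with h | h
  · exact rootKernel_mul_of_lt hH hH1 h
  · have := rootKernel_mul_of_lt hH hH1 h
    rw [abs_sub_comm]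
    simpa only [mul_comm (rootKernel H s _)] using this

lemma ae_quadrant_ne : ∀ᵐ z ∂quadrant, z.1 ≠ z.2 := by
  have hm : MeasurableSet {z : ℝ × ℝ | z.1 ≠ z.2} :=
    (measurableSet_eq_fun measurable_fst measurable_snd).compl
  rw [quadrant, Measure.ae_prod_iff_ae_ae hm]
  refine Eventually.of_forall fun s => ?_
  have : ∀ᵐ t ∂(volume : Measure ℝ), t ≠ s := by simp [ae_iff]
  filter_upwards [ae_restrict_of_ae this] with t ht using ht.symm

/-- The form is positive semidefinite: off the diagonal, which is a null set, the kernel is a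
positive multiple of `∫ r, rootKernel H s r * rootKernel H t r`. -/
lemma phiNormSq_nonneg (hH : 1 / 2 < H) (hH1 : H < 1) (hf : IsIntegrand H f) :
    0 ≤ phiNormSq H f := by
  have hc : 0 < H * (2 * H - 1) := mul_pos (by linarith) (by linarith)
  have hr := rootConst_pos hH hH1
  have hm : Measurable (Function.uncurry (rootKernel H)) := by
    unfold rootKernel Function.uncurry
    exact Measurable.ite (measurableSet_lt measurable_snd measurable_fst) (by fun_prop)
      measurable_const
  have e : ∀ z : ℝ × ℝ, f z.1 * f z.2 * (rootConst H * |z.1 - z.2| ^ (2 * H - 2))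
      = (rootConst H / (H * (2 * H - 1))) * phiIntegrand H f z := by
    intro z
    rw [phiIntegrand, phi]
    linear_combination
      (-(rootConst H * f z.1 * f z.2 * |z.1 - z.2| ^ (2 * H - 2))) * div_self hc.ne'
  have h := integral_mul_kernel_nonneg (m := volume.restrict (Set.Ioi (0 : ℝ)))
    (ν := (volume : Measure ℝ)) (K := rootKernel H)
    (k := fun z => rootConst H * |z.1 - z.2| ^ (2 * H - 2)) hf.1 hm
    (fun s r => by
      rw [rootKernel]
      split_ifs with h
      · exact Real.rpow_nonneg (by linarith) _
      · exact le_rfl)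
    (ae_quadrant_ne.mono fun z hz => (rootKernel_mul hH hH1 hz).1)
    (ae_quadrant_ne.mono fun z hz => (rootKernel_mul hH hH1 hz).2)
    (by simp only [e]; exact hf.2.const_mul _)
  simp only [e, integral_const_mul] at h
  exact nonneg_of_mul_nonneg_right h (by positivity)

namespace IsBddIntegrable

lemma phiNormSq_nonneg (hH : 1 / 2 < H) (hH1 : H < 1) (hf : IsBddIntegrable f) :
    0 ≤ phiNormSq H f :=
  FracSelfAttracting.phiNormSq_nonneg hH hH1 (hf.isIntegrand hH hH1)

end IsBddIntegrable

/-- Cauchy-Schwarz inequality. -/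
lemma phiInner_sq_le (hH : 1 / 2 < H) (hH1 : H < 1) (hf : IsBddIntegrable f)
    (hg : IsBddIntegrable g) : phiInner H f g ^ 2 ≤ phiNormSq H f * phiNormSq H g := by
  have h : ∀ c : ℝ, 0 ≤ phiNormSq H g * (c * c) + 2 * phiInner H f g * c + phiNormSq H f := by
    intro c
    have h1 := (hf.add (hg.const_mul c)).phiNormSq_nonneg hH hH1
    rw [phiNormSq_add_const_mul hH hH1 hf hg] at h1
    linarith
  have := discrim_le_zero h
  rw [discrim] at this
  linarith

lemma phiNormSq_sub_le (hH : 1 / 2 < H) (hH1 : H < 1) (hf : IsBddIntegrable f)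
    (hg : IsBddIntegrable g) :
    phiNormSq H (fun s => f s - g s) ≤ 2 * phiNormSq H f + 2 * phiNormSq H g := by
  have h1 := (hf.add (hg.const_mul 1)).phiNormSq_nonneg hH hH1
  have h2 := phiNormSq_add_const_mul hH hH1 hf hg (-1)
  rw [phiNormSq_add_const_mul hH hH1 hf hg] at h1
  have e : (fun s => f s - g s) = fun s => f s + -1 * g s := by ext s; ring
  rw [e, h2]
  linarith

/-- `∫_0^s φ(x, y) dy`. -/
lemma integral_phi (hH : 1 / 2 < H) (x s : ℝ) :
    ∫ y in (0 : ℝ)..s, phi H x y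
      = H * (|x| ^ (2 * H - 2) * x) - H * (|x - s| ^ (2 * H - 2) * (x - s)) := by
  have hp : -1 < 2 * H - 2 := by linarith
  have h1 : 2 * H - 1 ≠ 0 := by linarith
  simp only [phi]
  rw [intervalIntegral.integral_const_mul,
    intervalIntegral.integral_comp_sub_left (fun y => |y| ^ (2 * H - 2)) x, sub_zero,
    ← intervalIntegral.integral_interval_sub_left (intervalIntegrable_abs_rpow hp 0 x)
      (intervalIntegrable_abs_rpow hp 0 (x - s)), integral_zero_abs_rpow hp,
    integral_zero_abs_rpow hp, show 2 * H - 2 + 1 = 2 * H - 1 by ring]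
  linear_combination
    H * (|x| ^ (2 * H - 2) * x - |x - s| ^ (2 * H - 2) * (x - s)) * div_self h1

lemma hasDerivAt_abs_rpow_two_mul (hH : 1 / 2 < H) (x : ℝ) :
    HasDerivAt (fun x : ℝ => |x| ^ (2 * H) / 2) (H * (|x| ^ (2 * H - 2) * x)) x := by
  refine ((hasDerivAt_abs_rpow x (show 1 < 2 * H by linarith)).div_const 2).congr_deriv ?_
  ring

lemma continuous_abs_rpow_mul (hH : 1 / 2 < H) :
    Continuous fun x : ℝ => H * (|x| ^ (2 * H - 2) * x) := by
  have hp : 0 < 2 * H - 1 := by linarith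
  have h0 : Continuous fun x : ℝ => |x| ^ (2 * H - 1) :=
    continuous_abs.rpow_const fun x => Or.inr hp.le
  refine continuous_const.mul (continuous_iff_continuousAt.2 fun x => ?_)
  rcases eq_or_ne x 0 with rfl | hx
  · refine tendsto_of_tendsto_of_dist (f₁ := fun _ => (0 : ℝ)) (by simp) ?_
    have : Tendsto (fun x : ℝ => |x| ^ (2 * H - 1)) (𝓝 0) (𝓝 0) := by
      simpa [Real.zero_rpow hp.ne'] using h0.tendsto 0
    refine this.congr fun x => ?_
    rcases eq_or_ne x 0 with rfl | hx
    · simp [Real.zero_rpow hp.ne']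
    · have e : |x| ^ (2 * H - 1) = |x| ^ (2 * H - 2) * |x| := by
        rw [← Real.rpow_add_one (abs_ne_zero.2 hx)]; ring_nf
      rw [e, dist_comm, Real.dist_eq, sub_zero, abs_mul,
        abs_of_nonneg (Real.rpow_nonneg (abs_nonneg x) _)]
  · exact (continuous_abs.continuousAt.rpow_const (Or.inl (abs_ne_zero.2 hx))).mul
      continuousAt_id

/-- The inner product of two intervals that start at the origin is the covariance of fractional
Brownian motion. -/
lemma phiInner_indicator (hH : 1 / 2 < H) (hH1 : H < 1) {t s : ℝ} (ht : 0 ≤ t) (hs : 0 ≤ s) :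
    phiInner H ((Set.Ioc (0 : ℝ) t).indicator fun _ => (1 : ℝ))
      ((Set.Ioc (0 : ℝ) s).indicator fun _ => (1 : ℝ))
      = (t ^ (2 * H) + s ^ (2 * H) - |t - s| ^ (2 * H)) / 2 := by
  have hint := (isBddIntegrable_indicator_Ioc t).integrable_mul_phi hH hH1
    (isBddIntegrable_indicator_Ioc s)
  rw [phiInner, quadrant, integral_prod _ hint]
  have hin : ∀ x : ℝ, ∫ y in Set.Ioi (0 : ℝ), (Set.Ioc (0 : ℝ) t).indicator (fun _ => (1 : ℝ)) x *
      (Set.Ioc (0 : ℝ) s).indicator (fun _ => (1 : ℝ)) y * phi H x y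
      = (Set.Ioc (0 : ℝ) t).indicator (fun x => ∫ y in (0 : ℝ)..s, phi H x y) x := by
    intro x
    have e : ∀ y, (Set.Ioc (0 : ℝ) t).indicator (fun _ => (1 : ℝ)) x *
      (Set.Ioc (0 : ℝ) s).indicator (fun _ => (1 : ℝ)) y * phi H x y
      = (Set.Ioc (0 : ℝ) t).indicator (fun _ => (1 : ℝ)) x *
        (Set.Ioc (0 : ℝ) s).indicator (fun y => phi H x y) y := by
      intro y
      by_cases h : y ∈ Set.Ioc (0 : ℝ) s <;> simp [h]
    simp only [e]
    rw [integral_const_mul, setIntegral_indicator measurableSet_Ioc,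
      Set.inter_eq_right.2 Set.Ioc_subset_Ioi_self]
    by_cases h : x ∈ Set.Ioc (0 : ℝ) t
    · simp only [Set.indicator_of_mem h, one_mul, intervalIntegral.integral_of_le hs]
    · simp only [Set.indicator_of_notMem h, zero_mul]
  simp only [hin]
  rw [setIntegral_indicator measurableSet_Ioc, Set.inter_eq_right.2 Set.Ioc_subset_Ioi_self,
    ← intervalIntegral.integral_of_le ht]
  simp only [integral_phi hH]
  have hc := continuous_abs_rpow_mul hH
  have hc' : Continuous fun x : ℝ => H * (|x - s| ^ (2 * H - 2) * (x - s)) :=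
    hc.comp (continuous_id.sub continuous_const)
  have hFTC : ∀ a b : ℝ, ∫ x in a..b, H * (|x| ^ (2 * H - 2) * x)
      = |b| ^ (2 * H) / 2 - |a| ^ (2 * H) / 2 := fun a b =>
    intervalIntegral.integral_eq_sub_of_hasDerivAt
      (fun x _ => hasDerivAt_abs_rpow_two_mul hH x) (hc.intervalIntegrable a b)
  rw [intervalIntegral.integral_sub (hc.intervalIntegrable _ _) (hc'.intervalIntegrable _ _),
    intervalIntegral.integral_comp_sub_right (fun x => H * (|x| ^ (2 * H - 2) * x)) s, hFTC, hFTC,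
    zero_sub, abs_neg, abs_of_nonneg ht, abs_of_nonneg hs, abs_zero,
    Real.zero_rpow (by linarith)]
  ring

/-- A function supported in `(0, t]` with values in `[0, 1]` satisfies
`‖f‖_φ² ≤ 2 H t ^ (2H - 1) ∫ f`. -/
lemma phiNormSq_le_of_support (hH : 1 / 2 < H) (hH1 : H < 1) {t : ℝ} (ht : 0 < t)
    (hf : IsBddIntegrable f) (h0 : ∀ s, 0 ≤ f s) (h1 : ∀ s, f s ≤ 1)
    (hsupp : ∀ s, s ∉ Set.Ioc 0 t → f s = 0) :
    phiNormSq H f ≤ 2 * H * t ^ (2 * H - 1) * ∫ s in Set.Ioi (0 : ℝ), f s := by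
  have hI := isBddIntegrable_indicator_Ioc t
  have hint := hf.integrable_mul_phi hH hH1 hI
  have hle : phiNormSq H f
      ≤ phiInner H f ((Set.Ioc (0 : ℝ) t).indicator fun _ => (1 : ℝ)) := by
    refine integral_mono (hf.integrable_mul_phi hH hH1 hf) hint fun z => ?_
    have h2 : f z.2 ≤ (Set.Ioc (0 : ℝ) t).indicator (fun _ => (1 : ℝ)) z.2 := by
      by_cases h : z.2 ∈ Set.Ioc (0 : ℝ) t
      · simpa [h] using h1 z.2
      · simp [h, hsupp _ h]
    exact mul_le_mul_of_nonneg_right (mul_le_mul_of_nonneg_left h2 (h0 _)) (phi_nonneg hH _ _)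
  refine hle.trans ?_
  rw [phiInner, quadrant, integral_prod _ hint, ← integral_const_mul]
  refine integral_mono hint.integral_prod_left (hf.1.const_mul _) fun x => ?_
  have e : ∀ y, f x * (Set.Ioc (0 : ℝ) t).indicator (fun _ => (1 : ℝ)) y * phi H x y
      = f x * (Set.Ioc (0 : ℝ) t).indicator (fun y => phi H x y) y := by
    intro y
    by_cases h : y ∈ Set.Ioc (0 : ℝ) t <;> simp [h]
  simp only [e]
  rw [integral_const_mul, setIntegral_indicator measurableSet_Ioc,
    Set.inter_eq_right.2 Set.Ioc_subset_Ioi_self, ← intervalIntegral.integral_of_le ht.le,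
    integral_phi hH, mul_comm (f x)]
  by_cases hx : x ∈ Set.Ioc 0 t
  · refine mul_le_mul_of_nonneg_right ?_ (h0 x)
    have hp : 0 < 2 * H - 1 := by linarith
    have key : ∀ y : ℝ, 0 ≤ y → y ≤ t → |y| ^ (2 * H - 2) * y ≤ t ^ (2 * H - 1) := by
      intro y hy hyt
      rcases hy.eq_or_lt with rfl | hy'
      · rw [mul_zero]; positivity
      · rw [abs_of_pos hy', ← Real.rpow_add_one hy'.ne',
          show 2 * H - 2 + 1 = 2 * H - 1 by ring]
        exact Real.rpow_le_rpow hy hyt hp.le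
    have k1 := key x hx.1.le hx.2
    have k2 := key (t - x) (by linarith [hx.2]) (by linarith [hx.1])
    rw [abs_sub_comm x t]
    nlinarith
  · simp [hsupp x hx]

end FracSelfAttracting

namespace FracSelfAttracting

/-! ### The isometry and the integral of bounded integrable functions -/

lemma stepFun_eq_linearCombination (p : ℝ≥0 →₀ ℝ) (s : ℝ) :
    stepFun p s = Finsupp.linearCombination ℝ
      (fun t : ℝ≥0 => (Set.Ioc (0 : ℝ) t).indicator (fun _ => (1 : ℝ)) s) p := rfl

lemma stepIntegral_eq_linearCombination {Ω : Type*} (B : ℝ≥0 → Ω → ℝ) (p : ℝ≥0 →₀ ℝ) (ω : Ω) :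
    stepIntegral B p ω = Finsupp.linearCombination ℝ (fun t : ℝ≥0 => B t ω) p := rfl

lemma stepFun_sub (p q : ℝ≥0 →₀ ℝ) (s : ℝ) : stepFun (p - q) s = stepFun p s - stepFun q s := by
  simp only [stepFun_eq_linearCombination, map_sub]

lemma stepIntegral_sub {Ω : Type*} (B : ℝ≥0 → Ω → ℝ) (p q : ℝ≥0 →₀ ℝ) (ω : Ω) :
    stepIntegral B (p - q) ω = stepIntegral B p ω - stepIntegral B q ω := by
  simp only [stepIntegral_eq_linearCombination, map_sub]

variable {Ω : Type*} [MeasurableSpace Ω] {μ : Measure Ω} {H : ℝ} {B : ℝ≥0 → Ω → ℝ}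
  {f g w : ℝ → ℝ} {I J : Ω → ℝ}

lemma IsBddIntegrable.sum {ι : Type*} (S : Finset ι) {F : ι → ℝ → ℝ}
    (hF : ∀ i, IsBddIntegrable (F i)) : IsBddIntegrable fun s => ∑ i ∈ S, F i s := by
  classical
  induction S using Finset.induction_on with
  | empty => simpa using (isBddIntegrable_indicator_Ioc 0).const_mul 0
  | insert i S hi ih => simpa [Finset.sum_insert hi] using (hF i).add ih

lemma isBddIntegrable_stepFun (p : ℝ≥0 →₀ ℝ) : IsBddIntegrable (stepFun p) :=
  IsBddIntegrable.sum p.support fun t => (isBddIntegrable_indicator_Ioc t).const_mul (p t)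

lemma phiInner_sum_left (hH : 1 / 2 < H) (hH1 : H < 1) {ι : Type*} (S : Finset ι) (c : ι → ℝ)
    {F : ι → ℝ → ℝ} (hF : ∀ i, IsBddIntegrable (F i)) (hw : IsBddIntegrable w) :
    phiInner H (fun s => ∑ i ∈ S, c i * F i s) w = ∑ i ∈ S, c i * phiInner H (F i) w := by
  classical
  induction S using Finset.induction_on with
  | empty => simp [phiInner]
  | insert i S hi ih =>
    simp only [Finset.sum_insert hi]
    rw [phiInner_add_left hH hH1 ((hF i).const_mul (c i))
      (IsBddIntegrable.sum S fun j => (hF j).const_mul (c j)) hw, phiInner_const_mul_left, ih]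

lemma IsFractionalBrownianMotion.memLp (hB : IsFractionalBrownianMotion H B μ) (t : ℝ≥0) :
    MemLp (B t) 2 μ :=
  (hB.isGaussianProcess.hasGaussianLaw_eval t).memLp_two

lemma IsFractionalBrownianMotion.memLp_stepIntegral (hB : IsFractionalBrownianMotion H B μ)
    (p : ℝ≥0 →₀ ℝ) : MemLp (stepIntegral B p) 2 μ :=
  memLp_finsetSum p.support fun t _ => (hB.memLp t).const_mul (p t)

/-- The isometry for step functions. -/
lemma IsFractionalBrownianMotion.integral_stepIntegral_sq
    (hB : IsFractionalBrownianMotion H B μ) (hH : 1 / 2 < H) (hH1 : H < 1) (p : ℝ≥0 →₀ ℝ) :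
    ∫ ω, stepIntegral B p ω ^ 2 ∂μ = phiNormSq H (stepFun p) := by
  have hI := fun t : ℝ≥0 => isBddIntegrable_indicator_Ioc (t : ℝ)
  have h1 : phiNormSq H (stepFun p) = ∑ t ∈ p.support, p t * ∑ s ∈ p.support, p s *
      phiInner H ((Set.Ioc (0 : ℝ) s).indicator fun _ => (1 : ℝ))
        ((Set.Ioc (0 : ℝ) t).indicator fun _ => (1 : ℝ)) := by
    rw [phiNormSq_eq]
    change phiInner H (fun s => ∑ t ∈ p.support, p t * _) _ = _
    rw [phiInner_sum_left hH hH1 _ _ hI (isBddIntegrable_stepFun p)]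
    refine Finset.sum_congr rfl fun t _ => ?_
    rw [phiInner_comm]
    change _ * phiInner H (fun s => ∑ t ∈ p.support, p t * _) _ = _
    rw [phiInner_sum_left hH hH1 _ _ hI (hI t)]
  have h2 : ∀ ω, stepIntegral B p ω ^ 2
      = ∑ t ∈ p.support, p t * ∑ s ∈ p.support, p s * (B s ω * B t ω) := by
    intro ω
    rw [sq, stepIntegral, Finsupp.sum, Finset.sum_mul]
    refine Finset.sum_congr rfl fun t _ => ?_
    rw [mul_assoc, Finset.mul_sum]
    exact congrArg _ (Finset.sum_congr rfl fun s _ => by ring)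
  have hint : ∀ t s : ℝ≥0, Integrable (fun ω => p s * (B s ω * B t ω)) μ := fun t s =>
    ((hB.memLp s).integrable_mul (hB.memLp t)).const_mul (p s)
  simp only [h2]
  rw [integral_finsetSum _ fun t _ =>
    (integrable_finsetSum _ fun s _ => hint t s).const_mul (p t), h1]
  refine Finset.sum_congr rfl fun t _ => ?_
  rw [integral_const_mul, integral_finsetSum _ fun s _ => hint t s]
  refine congrArg _ (Finset.sum_congr rfl fun s _ => ?_)
  rw [integral_const_mul, hB.covariance t s, phiInner_indicator hH hH1 s.coe_nonneg t.coe_nonneg]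

lemma eLpNorm_two_eq_ofReal_sqrt {F : Ω → ℝ} (hF : MemLp F 2 μ) :
    eLpNorm F 2 μ = ENNReal.ofReal √(∫ ω, F ω ^ 2 ∂μ) := by
  rw [hF.eLpNorm_eq_integral_rpow_norm (by simp) (by simp), Real.sqrt_eq_rpow]
  simp

lemma norm_toLp_two_sq {F : Ω → ℝ} (hF : MemLp F 2 μ) : ‖hF.toLp F‖ ^ 2 = ∫ ω, F ω ^ 2 ∂μ := by
  rw [Lp.norm_toLp, eLpNorm_two_eq_ofReal_sqrt hF, ENNReal.toReal_ofReal (Real.sqrt_nonneg _),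
    Real.sq_sqrt (integral_nonneg fun ω => sq_nonneg _)]

/-- The seminorm `‖·‖_φ` is continuous for itself. -/
lemma tendsto_phiNormSq_of_sub (hH : 1 / 2 < H) (hH1 : H < 1) (hf : IsBddIntegrable f)
    {F : ℕ → ℝ → ℝ} (hF : ∀ n, IsBddIntegrable (F n))
    (h : Tendsto (fun n => phiNormSq H fun s => f s - F n s) atTop (𝓝 0)) :
    Tendsto (fun n => phiNormSq H (F n)) atTop (𝓝 (phiNormSq H f)) := by
  have hsub := fun n => hf.sub (hF n)
  have hin : Tendsto (fun n => phiInner H f fun s => f s - F n s) atTop (𝓝 0) := by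
    have h1 : Tendsto (fun n => √(phiNormSq H f * phiNormSq H fun s => f s - F n s)) atTop
        (𝓝 0) := by
      simpa using (h.const_mul (phiNormSq H f)).sqrt
    refine squeeze_zero_norm (fun n => ?_) h1
    exact Real.abs_le_sqrt (phiInner_sq_le hH hH1 hf (hsub n))
  have e : ∀ n, phiNormSq H (F n) = phiNormSq H f + 2 * (-1) * phiInner H f (fun s => f s - F n s)
      + (-1) ^ 2 * phiNormSq H fun s => f s - F n s := by
    intro n
    rw [← phiNormSq_add_const_mul hH hH1 hf (hsub n)]
    exact congrArg _ (funext fun s => by ring)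
  simp only [e]
  have h2 := ((tendsto_const_nhds (x := phiNormSq H f)).add (hin.const_mul (2 * (-1)))).add
    (h.const_mul ((-1) ^ 2))
  rwa [mul_zero, mul_zero, add_zero, add_zero] at h2

/-- The isometry, which passes to limits of step functions because both sides are continuous. -/
lemma HasFbmIntegral.integral_sq (hB : IsFractionalBrownianMotion H B μ) (hH : 1 / 2 < H)
    (hH1 : H < 1) (hf : IsBddIntegrable f) (hI : HasFbmIntegral H B μ f I) :
    ∫ ω, I ω ^ 2 ∂μ = phiNormSq H f := by
  obtain ⟨p, hp, hpI⟩ := hI.exists_approx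
  have hstep := fun n => hB.memLp_stepIntegral (p n)
  have h1 : Tendsto (fun n => (hstep n).toLp _) atTop (𝓝 (hI.memLp.toLp I)) := by
    refine (Lp.tendsto_Lp_iff_tendsto_eLpNorm'' _ hstep _ hI.memLp).2 ?_
    refine hpI.congr fun n => ?_
    rw [eLpNorm_sub_comm]
    rfl
  have h2 := (h1.norm).pow 2
  simp only [norm_toLp_two_sq, hB.integral_stepIntegral_sq hH hH1] at h2
  exact tendsto_nhds_unique h2
    (tendsto_phiNormSq_of_sub hH hH1 hf (fun n => isBddIntegrable_stepFun (p n)) hp)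

lemma HasFbmIntegral.sub (hB : IsFractionalBrownianMotion H B μ) (hH : 1 / 2 < H)
    (hH1 : H < 1) (hf : IsBddIntegrable f) (hg : IsBddIntegrable g)
    (hI : HasFbmIntegral H B μ f I) (hJ : HasFbmIntegral H B μ g J) :
    HasFbmIntegral H B μ (fun s => f s - g s) fun ω => I ω - J ω := by
  obtain ⟨p, hp, hpI⟩ := hI.exists_approx
  obtain ⟨q, hq, hqJ⟩ := hJ.exists_approx
  refine ⟨(hf.sub hg).isIntegrand hH hH1, hI.memLp.sub hJ.memLp, fun n => p n - q n, ?_, ?_⟩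
  · have hfp := fun n => hf.sub (isBddIntegrable_stepFun (p n))
    have hgq := fun n => hg.sub (isBddIntegrable_stepFun (q n))
    have e : ∀ n, (fun s => f s - g s - stepFun (p n - q n) s)
        = fun s => (f s - stepFun (p n) s) - (g s - stepFun (q n) s) := by
      intro n; ext s; rw [stepFun_sub]; ring
    refine squeeze_zero (g := fun n => 2 * phiNormSq H (fun s => f s - stepFun (p n) s)
      + 2 * phiNormSq H (fun s => g s - stepFun (q n) s)) (fun n => ?_) (fun n => ?_) ?_
    · rw [e]; exact ((hfp n).sub (hgq n)).phiNormSq_nonneg hH hH1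
    · rw [e]; exact phiNormSq_sub_le hH hH1 (hfp n) (hgq n)
    · simpa using (hp.const_mul 2).add (hq.const_mul 2)
  · have h := hpI.add hqJ
    rw [add_zero] at h
    refine tendsto_of_tendsto_of_tendsto_of_le_of_le tendsto_const_nhds h (fun n => zero_le)
      fun n => ?_
    have e : (fun ω => I ω - J ω - stepIntegral B (p n - q n) ω)
        = (fun ω => I ω - stepIntegral B (p n) ω) - fun ω => J ω - stepIntegral B (q n) ω := by
      ext ω
      simp only [stepIntegral_sub, Pi.sub_apply]
      ring
    rw [e]
    exact eLpNorm_sub_le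
      (hI.memLp.sub (hB.memLp_stepIntegral _)).aestronglyMeasurable
      (hJ.memLp.sub (hB.memLp_stepIntegral _)).aestronglyMeasurable (by norm_num)

/-- By the isometry and completeness of `L²`, the integrals of an approximating sequence of step
functions converge. -/
lemma exists_hasFbmIntegral_of_tendsto (hB : IsFractionalBrownianMotion H B μ) (hH : 1 / 2 < H)
    (hH1 : H < 1) (hf : IsBddIntegrable f) {p : ℕ → ℝ≥0 →₀ ℝ}
    (hp : Tendsto (fun n => phiNormSq H fun s => f s - stepFun (p n) s) atTop (𝓝 0)) :
    ∃ I : Ω → ℝ, HasFbmIntegral H B μ f I ∧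
      Tendsto (fun n => eLpNorm (fun ω => I ω - stepIntegral B (p n) ω) 2 μ) atTop (𝓝 0) := by
  have hstep := fun n => hB.memLp_stepIntegral (p n)
  have hfp := fun n => hf.sub (isBddIntegrable_stepFun (p n))
  have hcauchy : CauchySeq fun n => (hstep n).toLp (stepIntegral B (p n)) := by
    rw [Metric.cauchySeq_iff]
    intro ε hε
    obtain ⟨N, hN⟩ := eventually_atTop.1 (hp.eventually_lt_const (show 0 < ε ^ 2 / 4 by positivity))
    refine ⟨N, fun m hm n hn => ?_⟩
    have e : dist ((hstep m).toLp (stepIntegral B (p m))) ((hstep n).toLp (stepIntegral B (p n)))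
        ^ 2 = phiNormSq H (stepFun (p m - p n)) := by
      rw [dist_eq_norm, ← MemLp.toLp_sub, norm_toLp_two_sq, ← hB.integral_stepIntegral_sq hH hH1]
      simp only [stepIntegral_sub, Pi.sub_apply]
    have e2 : stepFun (p m - p n)
        = fun s => (f s - stepFun (p n) s) - (f s - stepFun (p m) s) := by
      ext s; rw [stepFun_sub]; ring
    have h1 := phiNormSq_sub_le hH hH1 (hfp n) (hfp m)
    rw [← e2, ← e] at h1
    have h2 := hN m hm
    have h3 := hN n hn
    exact lt_of_pow_lt_pow_left₀ 2 hε.le (by linarith)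
  obtain ⟨Z, hZ⟩ := cauchySeq_tendsto_of_complete hcauchy
  have hZ' : Tendsto (fun n => eLpNorm (fun ω => Z ω - stepIntegral B (p n) ω) 2 μ) atTop
      (𝓝 0) := by
    have h := (Lp.tendsto_Lp_iff_tendsto_eLpNorm'' _ hstep Z (Lp.memLp Z)).1 (by simpa using hZ)
    refine h.congr fun n => ?_
    rw [eLpNorm_sub_comm]
    rfl
  exact ⟨Z, ⟨hf.isIntegrand hH hH1, Lp.memLp Z, p, hp, hZ'⟩, hZ'⟩

lemma exists_hasFbmIntegral (hB : IsFractionalBrownianMotion H B μ) (hH : 1 / 2 < H)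
    (hH1 : H < 1) (hf : IsBddIntegrable f)
    (happ : ∀ ε : ℝ, 0 < ε → ∃ p, phiNormSq H (fun s => f s - stepFun p s) < ε) :
    ∃ I : Ω → ℝ, HasFbmIntegral H B μ f I := by
  choose p hp using fun n : ℕ => happ (1 / (n + 1)) Nat.one_div_pos_of_nat
  have h : Tendsto (fun n => phiNormSq H fun s => f s - stepFun (p n) s) atTop (𝓝 0) :=
    squeeze_zero (fun n => (hf.sub (isBddIntegrable_stepFun (p n))).phiNormSq_nonneg hH hH1)
      (fun n => (hp n).le) tendsto_one_div_add_atTop_nhds_zero_nat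
  obtain ⟨I, hI, -⟩ := exists_hasFbmIntegral_of_tendsto hB hH hH1 hf h
  exact ⟨I, hI⟩

/-- For uniformly bounded functions, convergence in `L¹` implies convergence in `‖·‖_φ`. -/
lemma tendsto_phiNormSq_zero (hH : 1 / 2 < H) (hH1 : H < 1) {ι : Type*} {l : Filter ι}
    {F : ι → ℝ → ℝ} {M : ℝ} (hF : ∀ i, IntegrableOn (F i) (Set.Ioi 0))
    (hM : ∀ᶠ i in l, ∀ s, 0 < s → |F i s| ≤ M)
    (h : Tendsto (fun i => ∫ s in Set.Ioi (0 : ℝ), |F i s|) l (𝓝 0)) :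
    Tendsto (fun i => phiNormSq H (F i)) l (𝓝 0) := by
  obtain ⟨C, -, hC⟩ := exists_integrable_and_abs_le hH hH1
  refine squeeze_zero_norm' (a := fun i => C * (∫ s in Set.Ioi (0 : ℝ), |F i s|)
    * ((∫ s in Set.Ioi (0 : ℝ), |F i s|) + M)) ?_ ?_
  · filter_upwards [hM] with i hi using (hC _ _ M (hF i) (hF i) hi).2
  · simpa using (h.const_mul C).mul (h.add_const M)

/-! ### Riemann sums -/

/-- The point `i T / n`, which is `0` for `n = 0`. -/
noncomputable def node (T : ℝ≥0) (n i : ℕ) : ℝ≥0 := T * i / n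

/-- The step function which on each of the intervals `(i T / n, (i + 1) T / n]`, `i < n`, takes the
value of `f` at the right endpoint. -/
noncomputable def riemannStep (f : ℝ → ℝ) (T : ℝ≥0) (n : ℕ) : ℝ≥0 →₀ ℝ :=
  ∑ i ∈ Finset.range n, (Finsupp.single (node T n (i + 1)) (f (node T n (i + 1)))
    - Finsupp.single (node T n i) (f (node T n (i + 1))))

lemma linearCombination_riemannStep (f : ℝ → ℝ) (T : ℝ≥0) (n : ℕ) (F : ℝ≥0 → ℝ) :
    Finsupp.linearCombination ℝ F (riemannStep f T n) =
      ∑ i ∈ Finset.range n, f (node T n (i + 1)) * (F (node T n (i + 1)) - F (node T n i)) := by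
  simp [riemannStep, mul_sub]

lemma node_zero (T : ℝ≥0) (n : ℕ) : node T n 0 = 0 := by simp [node]

lemma node_self (T : ℝ≥0) {n : ℕ} (hn : n ≠ 0) : node T n n = T := by
  have : (n : ℝ≥0) ≠ 0 := by exact_mod_cast hn
  rw [node, mul_div_assoc, div_self this, mul_one]

lemma node_mono (T : ℝ≥0) (n : ℕ) : Monotone (node T n) := by
  intro i j hij
  unfold node
  gcongr

lemma coe_node_succ (T : ℝ≥0) (n i : ℕ) :
    (node T n (i + 1) : ℝ) = node T n i + T / n := by
  simp only [node, NNReal.coe_div, NNReal.coe_mul, NNReal.coe_natCast]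
  push_cast
  ring

lemma coe_node_le (T : ℝ≥0) {n i : ℕ} (hi : i ≤ n) : (node T n i : ℝ) ≤ T := by
  rcases eq_or_ne n 0 with rfl | hn
  · simp [node]
  · have := node_mono T n hi
    rw [node_self T hn] at this
    exact_mod_cast this

/-- For large `n`, the step function `riemannStep f T n` is uniformly close to `f` on `(0, T]`. -/
lemma eventually_abs_sub_riemannStep_le {T : ℝ≥0} (hf : ContinuousOn f (Set.Icc 0 T)) {ε : ℝ}
    (hε : 0 < ε) : ∀ᶠ n : ℕ in atTop, ∀ s : ℝ,
      |(Set.Ioc (0 : ℝ) T).indicator f s - stepFun (riemannStep f T n) s|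
        ≤ ε * (Set.Ioc (0 : ℝ) T).indicator (fun _ => (1 : ℝ)) s := by
  have huc := isCompact_Icc.uniformContinuousOn_of_continuous hf
  rw [Metric.uniformContinuousOn_iff] at huc
  obtain ⟨δ, hδ, hδf⟩ := huc ε hε
  have hlim : Tendsto (fun n : ℕ => (T : ℝ) / n) atTop (𝓝 0) :=
    tendsto_const_div_atTop_nhds_zero_nat _
  filter_upwards [hlim.eventually_lt_const hδ, eventually_ne_atTop 0] with n hnδ hn s
  rw [stepFun_eq_linearCombination, linearCombination_riemannStep]
  set e : ℕ → ℝ := fun i => (Set.Ioc (0 : ℝ) (node T n i)).indicator (fun _ => (1 : ℝ)) s with he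
  have he0 : e 0 = 0 := by simp [he, node_zero]
  have hen : e n = (Set.Ioc (0 : ℝ) T).indicator (fun _ => (1 : ℝ)) s := by
    simp only [he, node_self T hn]
  have htel : ∑ i ∈ Finset.range n, (e (i + 1) - e i)
      = (Set.Ioc (0 : ℝ) T).indicator (fun _ => (1 : ℝ)) s := by
    rw [Finset.sum_range_sub, he0, hen, sub_zero]
  have hfs : (Set.Ioc (0 : ℝ) T).indicator f s
      = ∑ i ∈ Finset.range n, f s * (e (i + 1) - e i) := by
    rw [← Finset.mul_sum, htel]
    by_cases hs : s ∈ Set.Ioc (0 : ℝ) T <;> simp [hs]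
  rw [hfs, ← Finset.sum_sub_distrib, ← htel, Finset.mul_sum]
  refine (Finset.abs_sum_le_sum_abs _ _).trans (Finset.sum_le_sum fun i hi => ?_)
  change |f s * (e (i + 1) - e i) - f (node T n (i + 1)) * (e (i + 1) - e i)| ≤ _
  rw [← sub_mul, abs_mul]
  have hle : (node T n i : ℝ) ≤ node T n (i + 1) := by exact_mod_cast node_mono T n (Nat.le_succ i)
  by_cases h1 : s ∈ Set.Ioc (0 : ℝ) (node T n (i + 1))
  · by_cases h2 : s ∈ Set.Ioc (0 : ℝ) (node T n i)
    · simp [he, h1, h2]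
    · have hd : e (i + 1) - e i = 1 := by simp [he, h1, h2]
      have hs : (node T n i : ℝ) < s := by
        by_contra hlt
        exact h2 ⟨h1.1, not_lt.1 hlt⟩
      have hT := coe_node_le T (Finset.mem_range.1 hi : i + 1 ≤ n)
      have h3 := coe_node_succ T n i
      have h4 := (hδf s ⟨h1.1.le, h1.2.trans hT⟩ (node T n (i + 1)) ⟨NNReal.coe_nonneg _, hT⟩
        (by rw [Real.dist_eq, abs_lt]; constructor <;> linarith [h1.2])).le
      rw [Real.dist_eq] at h4
      simpa [hd] using h4
  · have h2 : s ∉ Set.Ioc (0 : ℝ) (node T n i) := fun h => h1 ⟨h.1, h.2.trans hle⟩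
    simp [he, h1, h2]

lemma isBddIntegrable_indicator_of_continuousOn {T : ℝ} (hf : ContinuousOn f (Set.Icc 0 T)) :
    IsBddIntegrable ((Set.Ioc (0 : ℝ) T).indicator f) := by
  obtain ⟨M, hM⟩ := isCompact_Icc.exists_bound_of_continuousOn hf
  refine ⟨Integrable.integrableOn ?_, max M 0, fun s _ => ?_⟩
  · rw [integrable_indicator_iff measurableSet_Ioc]
    exact (hf.integrableOn_Icc).mono_set Set.Ioc_subset_Icc_self
  · by_cases h : s ∈ Set.Ioc (0 : ℝ) T
    · rw [Set.indicator_of_mem h]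
      exact (hM s (Set.Ioc_subset_Icc_self h)).trans (le_max_left _ _)
    · simp [h]

lemma tendsto_phiNormSq_riemannStep (hH : 1 / 2 < H) (hH1 : H < 1) {T : ℝ≥0}
    (hf : ContinuousOn f (Set.Icc 0 T)) :
    Tendsto (fun n => phiNormSq H fun s =>
      (Set.Ioc (0 : ℝ) T).indicator f s - stepFun (riemannStep f T n) s) atTop (𝓝 0) := by
  have hb := fun n => (isBddIntegrable_indicator_of_continuousOn hf).sub
    (isBddIntegrable_stepFun (riemannStep f T n))
  have hind : ∀ s : ℝ, (Set.Ioc (0 : ℝ) T).indicator (fun _ => (1 : ℝ)) s ≤ 1 := fun s => by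
    by_cases h : s ∈ Set.Ioc (0 : ℝ) T <;> simp [h]
  refine tendsto_phiNormSq_zero hH hH1 (M := 1) (fun n => (hb n).1) ?_ ?_
  · filter_upwards [eventually_abs_sub_riemannStep_le hf one_pos] with n hn s _
    exact (hn s).trans (by simpa using hind s)
  · rw [NormedAddGroup.tendsto_nhds_zero]
    intro ε hε
    have hT : (0 : ℝ) ≤ T := T.2
    have hε' : 0 < ε / (T + 1) := by positivity
    filter_upwards [eventually_abs_sub_riemannStep_le hf hε'] with n hn
    rw [Real.norm_of_nonneg (integral_nonneg fun s => abs_nonneg _)]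
    have h1 := integral_mono (hb n).1.abs
      ((isBddIntegrable_indicator_Ioc T).1.const_mul (ε / (T + 1))) hn
    have h2 : ∫ s in Set.Ioi (0 : ℝ), (Set.Ioc (0 : ℝ) T).indicator (fun _ => (1 : ℝ)) s = T := by
      rw [setIntegral_indicator measurableSet_Ioc, Set.inter_eq_right.2 Set.Ioc_subset_Ioi_self]
      simp
    rw [integral_const_mul, h2] at h1
    refine h1.trans_lt ?_
    rw [div_mul_eq_mul_div, div_lt_iff₀ (by positivity)]
    nlinarith

lemma exists_hasFbmIntegral_indicator (hB : IsFractionalBrownianMotion H B μ) (hH : 1 / 2 < H)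
    (hH1 : H < 1) {T : ℝ≥0} (hf : ContinuousOn f (Set.Icc 0 T)) :
    ∃ I : Ω → ℝ, HasFbmIntegral H B μ ((Set.Ioc (0 : ℝ) T).indicator f) I ∧
      Tendsto (fun n => eLpNorm (fun ω => I ω - stepIntegral B (riemannStep f T n) ω) 2 μ) atTop
        (𝓝 0) :=
  exists_hasFbmIntegral_of_tendsto hB hH hH1 (isBddIntegrable_indicator_of_continuousOn hf)
    (tendsto_phiNormSq_riemannStep hH hH1 hf)

lemma tendsto_integral_abs_sub_indicator (hf : IsBddIntegrable f) :
    Tendsto (fun n : ℕ => ∫ s in Set.Ioi (0 : ℝ), |f s - (Set.Ioc (0 : ℝ) n).indicator f s|) atTop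
      (𝓝 0) := by
  have h : Tendsto (fun n : ℕ => ∫ s in Set.Ioi (0 : ℝ),
      |f s - (Set.Ioc (0 : ℝ) n).indicator f s|) atTop
      (𝓝 (∫ _ in Set.Ioi (0 : ℝ), (0 : ℝ))) := by
    refine tendsto_integral_of_dominated_convergence (fun s => |f s|) (fun n => ?_) hf.1.abs
      (fun n => ?_) ?_
    · exact (hf.1.sub (hf.1.indicator measurableSet_Ioc)).abs.aestronglyMeasurable
    · refine Eventually.of_forall fun s => ?_
      by_cases h : s ∈ Set.Ioc (0 : ℝ) n <;> simp [h]
    · filter_upwards [ae_restrict_mem measurableSet_Ioi] with s hs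
      refine tendsto_const_nhds.congr' ?_
      filter_upwards [eventually_ge_atTop ⌈s⌉₊] with n hn
      have : s ∈ Set.Ioc (0 : ℝ) n := ⟨hs, (Nat.ceil_le.1 hn)⟩
      simp [this]
  simpa using h

lemma exists_hasFbmIntegral_of_continuousOn (hB : IsFractionalBrownianMotion H B μ)
    (hH : 1 / 2 < H) (hH1 : H < 1) (hf : IsBddIntegrable f) (hc : ContinuousOn f (Set.Ici 0)) :
    ∃ I : Ω → ℝ, HasFbmIntegral H B μ f I := by
  refine exists_hasFbmIntegral hB hH hH1 hf fun ε hε => ?_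
  obtain ⟨M, hM⟩ := hf.bounded
  have hcn : ∀ n : ℕ, ContinuousOn f (Set.Icc 0 ((n : ℝ≥0) : ℝ)) := fun n =>
    hc.mono Set.Icc_subset_Ici_self
  have hfn := fun n => isBddIntegrable_indicator_of_continuousOn (hcn n)
  simp only [NNReal.coe_natCast] at hfn
  have htail : Tendsto (fun n : ℕ => phiNormSq H fun s =>
      (Set.Ioc (0 : ℝ) n).indicator f s - f s) atTop (𝓝 0) := by
    refine tendsto_phiNormSq_zero hH hH1 (M := M) (fun n => ((hfn n).sub hf).1) ?_ ?_
    · refine Eventually.of_forall fun n s hs => ?_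
      by_cases h : s ∈ Set.Ioc (0 : ℝ) n
      · simpa [h] using (abs_nonneg _).trans (hM s hs)
      · simpa [h] using hM s hs
    · simpa only [abs_sub_comm] using tendsto_integral_abs_sub_indicator hf
  obtain ⟨n, hn⟩ := (htail.eventually_lt_const (show 0 < ε / 4 by positivity)).exists
  obtain ⟨m, hm⟩ := ((tendsto_phiNormSq_riemannStep hH hH1 (hcn n)).eventually_lt_const
    (show 0 < ε / 4 by positivity)).exists
  rw [NNReal.coe_natCast] at hm
  refine ⟨riemannStep f n m, ?_⟩
  have h := phiNormSq_sub_le hH hH1 ((hfn n).sub (isBddIntegrable_stepFun (riemannStep f n m)))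
    ((hfn n).sub hf)
  have e : (fun s => ((Set.Ioc (0 : ℝ) n).indicator f s - stepFun (riemannStep f n m) s)
      - ((Set.Ioc (0 : ℝ) n).indicator f s - f s))
      = fun s => f s - stepFun (riemannStep f n m) s := by
    ext s; ring
  rw [e] at h
  linarith

end FracSelfAttracting

namespace FracSelfAttracting

/-! ### The Gaussian tail and the kernels `h` -/

variable {H a : ℝ}

/-- The Gaussian tail `∫_s^∞ e^{-a u² / 2} du`. -/
noncomputable def gaussTail (a s : ℝ) : ℝ := ∫ u in Set.Ioi s, Real.exp (-(a / 2) * u ^ 2)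

/-- The Mills ratio `e^{a s² / 2} ∫_s^∞ e^{-a u² / 2} du`, an antiderivative of `-h`. -/
noncomputable def mills (a s : ℝ) : ℝ := Real.exp (a / 2 * s ^ 2) * gaussTail a s

lemma exp_mul_exp_neg (a s : ℝ) :
    Real.exp (a / 2 * s ^ 2) * Real.exp (-(a / 2) * s ^ 2) = 1 := by
  rw [← Real.exp_add]; simp

lemma integrable_gauss (ha : 0 < a) : Integrable fun u : ℝ => Real.exp (-(a / 2) * u ^ 2) :=
  integrable_exp_neg_mul_sq (by positivity)

lemma integral_gauss_eq_sub (ha : 0 < a) (s t : ℝ) :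
    ∫ u in s..t, Real.exp (-(a / 2) * u ^ 2) = gaussTail a s - gaussTail a t := by
  have h := intervalIntegral.integral_interval_add_Ioi (a := s) (b := t)
    (integrable_gauss ha).integrableOn (integrable_gauss ha).integrableOn
  rw [gaussTail, gaussTail]
  linarith

lemma gaussTail_nonneg (a s : ℝ) : 0 ≤ gaussTail a s :=
  integral_nonneg fun _ => (Real.exp_pos _).le

lemma gaussTail_anti (ha : 0 < a) {s t : ℝ} (h : s ≤ t) : gaussTail a t ≤ gaussTail a s := by
  have := integral_gauss_eq_sub ha s t
  have h2 : 0 ≤ ∫ u in s..t, Real.exp (-(a / 2) * u ^ 2) :=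
    intervalIntegral.integral_nonneg h fun _ _ => (Real.exp_pos _).le
  linarith

lemma hasDerivAt_gaussTail (ha : 0 < a) (s : ℝ) :
    HasDerivAt (gaussTail a) (-Real.exp (-(a / 2) * s ^ 2)) s := by
  have hc : Continuous fun u : ℝ => Real.exp (-(a / 2) * u ^ 2) := by fun_prop
  have h := (hc.integral_hasStrictDerivAt 0 s).hasDerivAt.const_sub (gaussTail a 0)
  refine h.congr_of_eventuallyEq (Eventually.of_forall fun t => ?_)
  simp only [integral_gauss_eq_sub ha]
  ring

lemma hasDerivAt_exp_sq (a s : ℝ) : HasDerivAt (fun s : ℝ => Real.exp (a / 2 * s ^ 2))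
    (a * s * Real.exp (a / 2 * s ^ 2)) s := by
  have h := (((hasDerivAt_id s).pow 2).const_mul (a / 2)).exp
  refine h.congr_deriv ?_
  simp
  ring

lemma hasDerivAt_mills (ha : 0 < a) (s : ℝ) : HasDerivAt (mills a) (-hLim a s) s := by
  refine ((hasDerivAt_exp_sq a s).mul (hasDerivAt_gaussTail ha s)).congr_deriv ?_
  have h := exp_mul_exp_neg a s
  rw [hLim, ← gaussTail]
  linear_combination -h

lemma hasDerivAt_neg_mills (ha : 0 < a) (s : ℝ) :
    HasDerivAt (fun s => -mills a s) (hLim a s) s :=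
  (hasDerivAt_mills ha s).neg.congr_deriv (neg_neg _)

lemma mul_gaussTail_le (ha : 0 < a) (s : ℝ) :
    a * s * gaussTail a s ≤ Real.exp (-(a / 2) * s ^ 2) := by
  have hint : Integrable fun u : ℝ => u * Real.exp (-(a / 2) * u ^ 2) :=
    integrable_mul_exp_neg_mul_sq (by positivity)
  have hd : ∀ u : ℝ, HasDerivAt (fun u : ℝ => -(Real.exp (-(a / 2) * u ^ 2) / a))
      (u * Real.exp (-(a / 2) * u ^ 2)) u := by
    intro u
    refine ((((hasDerivAt_id u).pow 2).const_mul (-(a / 2))).exp.div_const a).neg.congr_deriv ?_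
    simp
    field_simp
  have hlim : Tendsto (fun u : ℝ => -(Real.exp (-(a / 2) * u ^ 2) / a)) atTop (𝓝 0) := by
    have h1 : Tendsto (fun u : ℝ => -(a / 2) * u ^ 2) atTop atBot :=
      (tendsto_pow_atTop two_ne_zero).const_mul_atTop_of_neg (by linarith)
    simpa using ((Real.tendsto_exp_atBot.comp h1).div_const a).neg
  have h1 := integral_Ioi_of_hasDerivAt_of_tendsto (a := s) (hd s).continuousAt.continuousWithinAt
    (fun u _ => hd u) hint.integrableOn hlim
  have h2 : s * gaussTail a s ≤ ∫ u in Set.Ioi s, u * Real.exp (-(a / 2) * u ^ 2) := by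
    rw [gaussTail, ← integral_const_mul]
    refine setIntegral_mono_on ((integrable_gauss ha).integrableOn.const_mul s) hint.integrableOn
      measurableSet_Ioi fun u hu => ?_
    exact mul_le_mul_of_nonneg_right (le_of_lt hu) (Real.exp_pos _).le
  rw [h1, zero_sub, neg_neg, le_div_iff₀ ha] at h2
  linarith

/-- The upper bound for the Mills ratio. -/
lemma mul_mills_le_one (ha : 0 < a) (s : ℝ) : a * s * mills a s ≤ 1 := by
  have h := mul_le_mul_of_nonneg_left (mul_gaussTail_le ha s) (Real.exp_pos (a / 2 * s ^ 2)).le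
  rw [exp_mul_exp_neg] at h
  rw [mills]
  linarith

lemma mills_nonneg (a s : ℝ) : 0 ≤ mills a s :=
  mul_nonneg (Real.exp_pos _).le (gaussTail_nonneg a s)

lemma mills_le (ha : 0 < a) {s : ℝ} (hs : 0 < s) : mills a s ≤ 1 / (a * s) := by
  rw [le_div_iff₀ (by positivity)]
  linarith [mul_mills_le_one ha s]

lemma hLim_eq (a s : ℝ) : hLim a s = 1 - a * s * mills a s := by
  rw [hLim, mills, gaussTail]; ring

lemma hLim_nonneg (ha : 0 < a) (s : ℝ) : 0 ≤ hLim a s := by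
  rw [hLim_eq]
  linarith [mul_mills_le_one ha s]

lemma hLim_le_one (ha : 0 < a) {s : ℝ} (hs : 0 ≤ s) : hLim a s ≤ 1 := by
  rw [hLim_eq]
  linarith [mul_nonneg (mul_nonneg ha.le hs) (mills_nonneg a s)]

lemma continuous_mills (ha : 0 < a) : Continuous (mills a) :=
  continuous_iff_continuousAt.2 fun s => (hasDerivAt_mills ha s).continuousAt

lemma continuous_hLim (ha : 0 < a) : Continuous (hLim a) := by
  have h : hLim a = fun s => 1 - a * s * mills a s := funext (hLim_eq a)
  rw [h]
  have := continuous_mills ha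
  fun_prop

lemma tendsto_one_div_const_mul (ha : 0 < a) :
    Tendsto (fun s : ℝ => 1 / (a * s)) atTop (𝓝 0) :=
  tendsto_const_nhds.div_atTop (tendsto_id.const_mul_atTop ha)

lemma tendsto_mills (ha : 0 < a) : Tendsto (mills a) atTop (𝓝 0) := by
  refine squeeze_zero' (Eventually.of_forall fun s => mills_nonneg a s) ?_
    (tendsto_one_div_const_mul ha)
  filter_upwards [eventually_gt_atTop 0] with s hs using mills_le ha hs

lemma integrableOn_hLim (ha : 0 < a) : IntegrableOn (hLim a) (Set.Ioi 0) := by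
  have hd := hasDerivAt_neg_mills ha
  refine integrableOn_Ioi_deriv_of_nonneg (hd 0).continuousAt.continuousWithinAt
    (fun s _ => hd s) (fun s _ => hLim_nonneg ha s) (tendsto_mills ha).neg

lemma isBddIntegrable_hLim (ha : 0 < a) : IsBddIntegrable (hLim a) :=
  ⟨integrableOn_hLim ha, 1, fun s hs => by
    rw [abs_of_nonneg (hLim_nonneg ha s)]; exact hLim_le_one ha hs.le⟩

/-- The coefficient `β(s) = -a e^{a s² / 2} ∫_s^t e^{-a u² / 2} du`, for which
`h(t, s) = 1 + s β(s)`. It solves `β' = a s β + a`, `β(t) = 0`. -/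
noncomputable def adjCoeff (a t s : ℝ) : ℝ :=
  -(a * Real.exp (a / 2 * s ^ 2) * (gaussTail a s - gaussTail a t))

/-- The derivative of `h(t, s)` in `s`. -/
noncomputable def derivKernel (a t s : ℝ) : ℝ := a * s + (1 + a * s ^ 2) * adjCoeff a t s

lemma adjCoeff_self (a t : ℝ) : adjCoeff a t t = 0 := by simp [adjCoeff]

lemma hasDerivAt_adjCoeff (ha : 0 < a) (t s : ℝ) :
    HasDerivAt (adjCoeff a t) (a * s * adjCoeff a t s + a) s := by
  have h := (((hasDerivAt_exp_sq a s).const_mul a).mul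
    ((hasDerivAt_gaussTail ha s).sub_const (gaussTail a t))).neg
  refine h.congr_deriv ?_
  rw [adjCoeff]
  linear_combination a * exp_mul_exp_neg a s

lemma hKernel_eq (ha : 0 < a) {s t : ℝ} (h : s ≤ t) : hKernel a t s = 1 + s * adjCoeff a t s := by
  rw [hKernel, if_pos h, integral_gauss_eq_sub ha, adjCoeff]; ring

lemma hasDerivAt_one_add_mul_adjCoeff (ha : 0 < a) (t s : ℝ) :
    HasDerivAt (fun s => 1 + s * adjCoeff a t s) (derivKernel a t s) s := by
  refine (((hasDerivAt_id s).mul (hasDerivAt_adjCoeff ha t s)).const_add 1).congr_deriv ?_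
  rw [derivKernel]
  simp only [id]
  ring

lemma continuous_adjCoeff (ha : 0 < a) (t : ℝ) : Continuous (adjCoeff a t) :=
  continuous_iff_continuousAt.2 fun s => (hasDerivAt_adjCoeff ha t s).continuousAt

lemma continuous_derivKernel (ha : 0 < a) (t : ℝ) : Continuous (derivKernel a t) := by
  have := continuous_adjCoeff ha t
  unfold derivKernel
  fun_prop

lemma indicator_hKernel (ha : 0 < a) (t : ℝ) : (Set.Ioc 0 t).indicator (hKernel a t)
    = (Set.Ioc 0 t).indicator fun s => 1 + s * adjCoeff a t s :=
  Set.indicator_congr fun _ hs => hKernel_eq ha hs.2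

lemma hKernel_sub_hLim (ha : 0 < a) {s t : ℝ} (h : s ≤ t) :
    hKernel a t s - hLim a s = gaussTail a t * (a * s * Real.exp (a / 2 * s ^ 2)) := by
  rw [hKernel_eq ha h, hLim_eq, adjCoeff, mills]; ring

lemma hKernel_sub_hLim_nonneg (ha : 0 < a) {s t : ℝ} (hs : 0 ≤ s) (h : s ≤ t) :
    0 ≤ hKernel a t s - hLim a s := by
  rw [hKernel_sub_hLim ha h]
  exact mul_nonneg (gaussTail_nonneg a t) (by positivity)

lemma hKernel_sub_hLim_le_one (ha : 0 < a) {s t : ℝ} (hs : 0 ≤ s) (h : s ≤ t) :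
    hKernel a t s - hLim a s ≤ 1 := by
  rw [hKernel_sub_hLim ha h]
  calc gaussTail a t * (a * s * Real.exp (a / 2 * s ^ 2))
      ≤ gaussTail a s * (a * s * Real.exp (a / 2 * s ^ 2)) :=
        mul_le_mul_of_nonneg_right (gaussTail_anti ha h) (by positivity)
    _ = a * s * mills a s := by rw [mills]; ring
    _ ≤ 1 := mul_mills_le_one ha s

lemma isBddIntegrable_indicator_hKernel (ha : 0 < a) (t : ℝ) :
    IsBddIntegrable ((Set.Ioc 0 t).indicator (hKernel a t)) := by
  rw [indicator_hKernel ha]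
  refine isBddIntegrable_indicator_of_continuousOn (Continuous.continuousOn ?_)
  have := continuous_adjCoeff ha t
  fun_prop

lemma continuousOn_hKernel_sub_hLim (ha : 0 < a) (t : ℝ) :
    ContinuousOn (fun s => hKernel a t s - hLim a s) (Set.Icc 0 t) := by
  have h : Continuous fun s => gaussTail a t * (a * s * Real.exp (a / 2 * s ^ 2)) := by fun_prop
  exact h.continuousOn.congr fun s hs => hKernel_sub_hLim ha hs.2

lemma setIntegral_hKernel_sub_hLim_le (ha : 0 < a) {t : ℝ} (ht : 0 < t) :
    ∫ s in Set.Ioi (0 : ℝ), (Set.Ioc 0 t).indicator (fun s => hKernel a t s - hLim a s) s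
      ≤ 1 / (a * t) := by
  rw [setIntegral_indicator measurableSet_Ioc, Set.inter_eq_right.2 Set.Ioc_subset_Ioi_self,
    setIntegral_congr_fun measurableSet_Ioc fun _ hs => hKernel_sub_hLim ha hs.2,
    ← intervalIntegral.integral_of_le ht.le, intervalIntegral.integral_const_mul,
    intervalIntegral.integral_eq_sub_of_hasDerivAt (fun s _ => hasDerivAt_exp_sq a s)
      (Continuous.intervalIntegrable (by fun_prop) _ _)]
  refine le_trans ?_ (mills_le ha ht)
  have h2 := mul_nonneg (gaussTail_nonneg a t) (Real.exp_pos (a / 2 * 0 ^ 2)).le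
  rw [mills]
  linarith

lemma phiNormSq_hKernel_sub_hLim_le (hH : 1 / 2 < H) (hH1 : H < 1) (ha : 0 < a) {t : ℝ}
    (ht : 0 < t) :
    phiNormSq H ((Set.Ioc 0 t).indicator fun s => hKernel a t s - hLim a s)
      ≤ 2 * H / (a * t ^ (2 - 2 * H)) := by
  have h := phiNormSq_le_of_support hH hH1 ht
    (isBddIntegrable_indicator_of_continuousOn (continuousOn_hKernel_sub_hLim ha t))
    (fun s => Set.indicator_nonneg (fun s hs => hKernel_sub_hLim_nonneg ha hs.1.le hs.2) s)
    (fun s => Set.indicator_apply_le' (fun hs => hKernel_sub_hLim_le_one ha hs.1.le hs.2)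
      fun _ => zero_le_one)
    (fun s hs => Set.indicator_of_notMem hs _)
  have hc : 0 ≤ 2 * H * t ^ (2 * H - 1) := mul_nonneg (by linarith) (Real.rpow_nonneg ht.le _)
  refine h.trans
    ((mul_le_mul_of_nonneg_left (setIntegral_hKernel_sub_hLim_le ha ht) hc).trans_eq ?_)
  have e : t ^ (2 * H - 1) * t ^ (2 - 2 * H) = t := by
    rw [← Real.rpow_add ht, show 2 * H - 1 + (2 - 2 * H) = 1 by ring, Real.rpow_one]
  have hp : 0 < t ^ (2 - 2 * H) := Real.rpow_pos_of_pos ht _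
  rw [mul_one_div, div_eq_div_iff (by positivity) (by positivity)]
  linear_combination 2 * H * a * e

lemma tendsto_integral_Ioi_hLim (ha : 0 < a) :
    Tendsto (fun t : ℝ => ∫ s in Set.Ioi t, hLim a s) atTop (𝓝 0) := by
  have hd := hasDerivAt_neg_mills ha
  refine (tendsto_mills ha).congr' ?_
  filter_upwards [eventually_ge_atTop 0] with t ht
  have h := integral_Ioi_of_hasDerivAt_of_tendsto (a := t) (hd t).continuousAt.continuousWithinAt
    (fun s _ => hd s) ((integrableOn_hLim ha).mono_set (Set.Ioi_subset_Ioi ht))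
    (by simpa using (tendsto_mills ha).neg)
  rw [h]; ring

lemma abs_indicator_hKernel_sub_hLim_le_one (ha : 0 < a) (t : ℝ) {s : ℝ} (hs : 0 < s) :
    |(Set.Ioc 0 t).indicator (hKernel a t) s - hLim a s| ≤ 1 := by
  by_cases h : s ∈ Set.Ioc 0 t
  · rw [Set.indicator_of_mem h, abs_of_nonneg (hKernel_sub_hLim_nonneg ha hs.le h.2)]
    exact hKernel_sub_hLim_le_one ha hs.le h.2
  · rw [Set.indicator_of_notMem h, zero_sub, abs_neg, abs_of_nonneg (hLim_nonneg ha s)]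
    exact hLim_le_one ha hs.le

/-- The kernels `h(t, ·)` on `(0, t]` converge to `h` in `L¹(0, ∞)`. -/
lemma tendsto_integral_abs_indicator_hKernel_sub_hLim (ha : 0 < a) :
    Tendsto (fun t : ℝ => ∫ s in Set.Ioi (0 : ℝ),
      |(Set.Ioc 0 t).indicator (hKernel a t) s - hLim a s|) atTop (𝓝 0) := by
  have h : Tendsto (fun t : ℝ => 1 / (a * t) + ∫ s in Set.Ioi t, hLim a s) atTop (𝓝 0) := by
    simpa only [add_zero] using (tendsto_one_div_const_mul ha).add (tendsto_integral_Ioi_hLim ha)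
  refine squeeze_zero' (Eventually.of_forall fun t => integral_nonneg fun s => abs_nonneg _) ?_ h
  filter_upwards [eventually_gt_atTop 0] with t ht
  have hsub : Set.Ioi t ⊆ Set.Ioi 0 := Set.Ioi_subset_Ioi ht.le
  have e : ∀ s ∈ Set.Ioi (0 : ℝ), |(Set.Ioc 0 t).indicator (hKernel a t) s - hLim a s|
      = (Set.Ioc 0 t).indicator (fun s => hKernel a t s - hLim a s) s
        + (Set.Ioi t).indicator (hLim a) s := by
    intro s hs
    have hs0 : 0 < s := hs
    rcases le_or_gt s t with h | h
    · have h1 : s ∈ Set.Ioc 0 t := ⟨hs0, h⟩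
      have h2 : s ∉ Set.Ioi t := not_lt.2 h
      rw [Set.indicator_of_mem h1, Set.indicator_of_mem h1, Set.indicator_of_notMem h2, add_zero,
        abs_of_nonneg (hKernel_sub_hLim_nonneg ha hs0.le h)]
    · have h1 : s ∉ Set.Ioc 0 t := fun h' => absurd h'.2 (not_le.2 h)
      have h2 : s ∈ Set.Ioi t := h
      rw [Set.indicator_of_notMem h1, Set.indicator_of_notMem h1, Set.indicator_of_mem h2,
        zero_sub, abs_neg, zero_add, abs_of_nonneg (hLim_nonneg ha s)]
  rw [setIntegral_congr_fun measurableSet_Ioi e, integral_add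
    (isBddIntegrable_indicator_of_continuousOn (continuousOn_hKernel_sub_hLim ha t)).1
    ((integrableOn_hLim ha).indicator measurableSet_Ioi)]
  refine add_le_add (setIntegral_hKernel_sub_hLim_le ha ht) (le_of_eq ?_)
  rw [setIntegral_indicator measurableSet_Ioi, Set.inter_eq_right.2 hsub]

end FracSelfAttracting

namespace FracSelfAttracting

/-! ### Solution of the equation along a path -/

lemma hasDerivAt_integral_of_continuousOn {g : ℝ → ℝ} {t s : ℝ}
    (hg : ContinuousOn g (Set.Icc 0 t)) (hs : s ∈ Set.Ioo 0 t) :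
    HasDerivAt (fun s => ∫ u in (0 : ℝ)..s, g u) (g s) s := by
  refine intervalIntegral.integral_hasDerivAt_right ?_ ?_ ?_
  · refine ContinuousOn.intervalIntegrable ?_
    rw [Set.uIcc_of_le hs.1.le]
    exact hg.mono (Set.Icc_subset_Icc_right hs.2.le)
  · exact (hg.mono Set.Ioo_subset_Icc_self).stronglyMeasurableAtFilter isOpen_Ioo s hs
  · exact hg.continuousAt (Icc_mem_nhds hs.1 hs.2)

/-- Variation of constants for the equation of the self-attracting diffusion along a path,
integrated by parts so that the driving path `F` need only be continuous. -/
lemma eq_sub_integral_derivKernel {a t : ℝ} (ha : 0 < a) (ht : 0 ≤ t) {x F : ℝ → ℝ}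
    (hx : IntervalIntegrable x volume 0 t) (hF : ContinuousOn F (Set.Icc 0 t))
    (heq : ∀ s ∈ Set.Icc 0 t,
      x s = F s - a * ∫ r in (0 : ℝ)..s, ∫ u in (0 : ℝ)..r, (x r - x u)) :
    x t = F t - ∫ s in (0 : ℝ)..t, F s * derivKernel a t s := by
  set P : ℝ → ℝ := fun s => ∫ u in (0 : ℝ)..s, x u with hP
  set D : ℝ → ℝ := fun s => s * x s - P s with hD
  set A : ℝ → ℝ := fun s => ∫ r in (0 : ℝ)..s, D r with hA
  have hsubint : ∀ s ∈ Set.Icc 0 t, IntervalIntegrable x volume 0 s := fun s hs =>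
    hx.mono_set (by
      rw [Set.uIcc_of_le hs.1, Set.uIcc_of_le ht]; exact Set.Icc_subset_Icc_right hs.2)
  have hxA : ∀ s ∈ Set.Icc 0 t, x s = F s - a * A s := by
    intro s hs
    rw [heq s hs]
    congr 2
    refine intervalIntegral.integral_congr fun r hr => ?_
    rw [Set.uIcc_of_le hs.1] at hr
    have hr' : r ∈ Set.Icc 0 t := ⟨hr.1, hr.2.trans hs.2⟩
    simp only [hD, hP]
    rw [intervalIntegral.integral_sub intervalIntegrable_const (hsubint r hr')]
    simp
  have hPc : ContinuousOn P (Set.Icc 0 t) := by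
    have := intervalIntegral.continuousOn_primitive_interval' hx (Set.left_mem_uIcc)
    rwa [Set.uIcc_of_le ht] at this
  have hDi : IntervalIntegrable D volume 0 t := by
    refine (hx.continuousOn_mul continuousOn_id).sub (ContinuousOn.intervalIntegrable ?_)
    rwa [Set.uIcc_of_le ht]
  have hAc : ContinuousOn A (Set.Icc 0 t) := by
    have := intervalIntegral.continuousOn_primitive_interval' hDi (Set.left_mem_uIcc)
    rwa [Set.uIcc_of_le ht] at this
  have hxc : ContinuousOn x (Set.Icc 0 t) :=
    (hF.sub (continuousOn_const.mul hAc)).congr hxA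
  have hDc : ContinuousOn D (Set.Icc 0 t) := (continuousOn_id.mul hxc).sub hPc
  have hβ := continuous_adjCoeff ha t
  have hk := continuous_derivKernel ha t
  -- With `y = x - F = -a A` and `R = s y - P`, the function `W = y + β R` has derivative
  -- `-F ∂ₛh(t, s)`, and only `y(t)` remains at the endpoints.
  have hWd : ∀ s ∈ Set.Ioo 0 t, HasDerivAt
      (fun s => -a * A s + adjCoeff a t s * (s * (-a * A s) - P s))
      (-(F s * derivKernel a t s)) s := by
    intro s hs
    have hAd : HasDerivAt A (D s) s := hasDerivAt_integral_of_continuousOn hDc hs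
    have hPd : HasDerivAt P (x s) s := hasDerivAt_integral_of_continuousOn hxc hs
    have h := (hAd.const_mul (-a)).add ((hasDerivAt_adjCoeff ha t s).mul
      (((hasDerivAt_id s).mul (hAd.const_mul (-a))).sub hPd))
    refine h.congr_deriv ?_
    have hxs := hxA s (Set.Ioo_subset_Icc_self hs)
    simp only [hD, Pi.sub_apply, Pi.mul_apply, id]
    rw [hxs, derivKernel]
    ring
  have hWc : ContinuousOn (fun s => -a * A s + adjCoeff a t s * (s * (-a * A s) - P s))
      (Set.Icc 0 t) := by
    have := hβ.continuousOn (s := Set.Icc 0 t)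
    fun_prop
  have hFTC := intervalIntegral.integral_eq_sub_of_hasDerivAt_of_le ht hWc hWd
    (ContinuousOn.intervalIntegrable (by
      rw [Set.uIcc_of_le ht]; exact (hF.mul hk.continuousOn).neg))
  have hA0 : A 0 = 0 := by simp [hA]
  have hP0 : P 0 = 0 := by simp [hP]
  rw [intervalIntegral.integral_neg, adjCoeff_self, hA0, hP0] at hFTC
  rw [hxA t (Set.right_mem_Icc.2 ht)]
  linarith

/-- Riemann-Stieltjes sums of a continuously differentiable function against a continuous path
converge, to the value given by integration by parts. -/
lemma tendsto_riemannStieltjes {h k b : ℝ → ℝ} {T : ℝ≥0} (hd : ∀ s, HasDerivAt h (k s) s)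
    (hk : Continuous k) (hb : ContinuousOn b (Set.Icc 0 T)) :
    Tendsto (fun n : ℕ => ∑ i ∈ Finset.range n,
      h (node T n (i + 1)) * (b (node T n (i + 1)) - b (node T n i))) atTop
      (𝓝 (h T * b T - h 0 * b 0 - ∫ s in (0 : ℝ)..T, b s * k s)) := by
  obtain ⟨K, hK⟩ := isCompact_Icc.exists_bound_of_continuousOn
    (hk.continuousOn (s := Set.Icc (0 : ℝ) T))
  have hT0 : (0 : ℝ) ≤ T := T.2
  have hK0 : 0 ≤ K := (norm_nonneg _).trans (hK 0 ⟨le_rfl, hT0⟩)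
  have huc := isCompact_Icc.uniformContinuousOn_of_continuous hb
  rw [Metric.uniformContinuousOn_iff] at huc
  rw [Metric.tendsto_nhds]
  intro ε hε
  have hη : 0 < ε / (K * T + 1) := by positivity
  obtain ⟨δ, hδ, hδb⟩ := huc _ hη
  have hlim : Tendsto (fun n : ℕ => (T : ℝ) / n) atTop (𝓝 0) :=
    tendsto_const_div_atTop_nhds_zero_nat _
  filter_upwards [hlim.eventually_lt_const hδ, eventually_ne_atTop 0] with n hnδ hn
  have hn' : (n : ℝ) ≠ 0 := by exact_mod_cast hn
  have hmem : ∀ i, i ≤ n → (node T n i : ℝ) ∈ Set.Icc (0 : ℝ) T := fun i hi =>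
    ⟨NNReal.coe_nonneg _, coe_node_le T hi⟩
  have hle : ∀ i, (node T n i : ℝ) ≤ node T n (i + 1) := fun i => by
    exact_mod_cast node_mono T n (Nat.le_succ i)
  have hsub : ∀ i, i < n → Set.Icc (node T n i : ℝ) (node T n (i + 1)) ⊆ Set.Icc 0 T :=
    fun i hi => Set.Icc_subset_Icc (hmem i hi.le).1 (hmem (i + 1) hi).2
  have hbk : ∀ i, i < n → IntervalIntegrable (fun s => b s * k s) volume
      (node T n i) (node T n (i + 1)) := fun i hi => by
    refine ContinuousOn.intervalIntegrable ?_
    rw [Set.uIcc_of_le (hle i)]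
    exact (hb.mono (hsub i hi)).mul hk.continuousOn
  have hki : ∀ i, IntervalIntegrable k volume (node T n i : ℝ) (node T n (i + 1)) :=
    fun i => hk.intervalIntegrable _ _
  have hsum := intervalIntegral.sum_integral_adjacent_intervals (a := fun i => (node T n i : ℝ)) hbk
  have htel : ∑ i ∈ Finset.range n, (h (node T n (i + 1)) * b (node T n (i + 1))
      - h (node T n i) * b (node T n i)) = h T * b T - h 0 * b 0 := by
    rw [Finset.sum_range_sub fun i => h (node T n i) * b (node T n i), node_self T hn, node_zero]
    rfl
  simp only [node_self T hn, node_zero, NNReal.coe_zero] at hsum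
  rw [← hsum, ← htel, Real.dist_eq, ← Finset.sum_sub_distrib, ← Finset.sum_sub_distrib]
  have hterm : ∀ i ∈ Finset.range n,
      |h (node T n (i + 1)) * (b (node T n (i + 1)) - b (node T n i))
        - (h (node T n (i + 1)) * b (node T n (i + 1)) - h (node T n i) * b (node T n i)
          - ∫ s in (node T n i : ℝ)..(node T n (i + 1)), b s * k s)|
      ≤ ε / (K * T + 1) * K * (T / n) := by
    intro i hi
    have hi' := Finset.mem_range.1 hi
    have h1 : h (node T n (i + 1)) - h (node T n i)
        = ∫ s in (node T n i : ℝ)..(node T n (i + 1)), k s :=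
      (intervalIntegral.integral_eq_sub_of_hasDerivAt (fun s _ => hd s) (hki i)).symm
    have h2 : h (node T n (i + 1)) * (b (node T n (i + 1)) - b (node T n i))
        - (h (node T n (i + 1)) * b (node T n (i + 1)) - h (node T n i) * b (node T n i)
          - ∫ s in (node T n i : ℝ)..(node T n (i + 1)), b s * k s)
        = ∫ s in (node T n i : ℝ)..(node T n (i + 1)), (b s - b (node T n i)) * k s := by
      simp only [sub_mul]
      rw [intervalIntegral.integral_sub (hbk i hi') ((hki i).const_mul _),
        intervalIntegral.integral_const_mul, ← h1]
      ring
    have hstep := coe_node_succ T n i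
    rw [h2, ← Real.norm_eq_abs]
    refine (intervalIntegral.norm_integral_le_of_norm_le_const
      (C := ε / (K * T + 1) * K) fun s hs => ?_).trans_eq ?_
    · rw [Set.uIoc_of_le (hle i)] at hs
      have hs' := hsub i hi' (Set.Ioc_subset_Icc_self hs)
      have h3 := (hδb s hs' (node T n i) (hmem i hi'.le)
        (by rw [Real.dist_eq, abs_lt]; constructor <;> linarith [hs.1, hs.2])).le
      rw [norm_mul]
      exact mul_le_mul h3 (hK s hs') (norm_nonneg _) hη.le
    · rw [hstep, add_sub_cancel_left, abs_of_nonneg (by positivity)]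
  refine (Finset.abs_sum_le_sum_abs _ _).trans_lt ((Finset.sum_le_sum hterm).trans_lt ?_)
  rw [Finset.sum_const, Finset.card_range, nsmul_eq_mul]
  have e : (n : ℝ) * (ε / (K * T + 1) * K * (T / n)) = ε * (K * T) / (K * T + 1) := by
    field_simp
  rw [e, div_lt_iff₀ (by positivity)]
  nlinarith

/-- Integration by parts turns the contribution of the drift into the integral of `h(t, ·)`. -/
lemma sub_integral_mul_derivKernel {a : ℝ} (ha : 0 < a) {t : ℝ} (ht : 0 ≤ t) :
    t - ∫ s in (0 : ℝ)..t, s * derivKernel a t s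
      = ∫ s in Set.Ioi (0 : ℝ), (Set.Ioc 0 t).indicator (hKernel a t) s := by
  have hβ := continuous_adjCoeff ha t
  have hk := continuous_derivKernel ha t
  have hh : Continuous fun s => 1 + s * adjCoeff a t s := by fun_prop
  have hsk : Continuous fun s => s * derivKernel a t s := by fun_prop
  rw [indicator_hKernel ha, setIntegral_indicator measurableSet_Ioc,
    Set.inter_eq_right.2 Set.Ioc_subset_Ioi_self, ← intervalIntegral.integral_of_le ht]
  have h := intervalIntegral.integral_eq_sub_of_hasDerivAt (a := 0) (b := t)
    (f := fun s => s * (1 + s * adjCoeff a t s))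
    (f' := fun s => (1 + s * adjCoeff a t s) + s * derivKernel a t s)
    (fun s _ => by
      refine ((hasDerivAt_id s).mul (hasDerivAt_one_add_mul_adjCoeff ha t s)).congr_deriv ?_
      simp) ((hh.add hsk).intervalIntegrable _ _)
  rw [intervalIntegral.integral_add (hh.intervalIntegrable _ _) (hsk.intervalIntegrable _ _),
    adjCoeff_self] at h
  linarith

/-! ### The diffusion as a stochastic integral -/

variable {Ω : Type*} [MeasurableSpace Ω] {μ : Measure Ω} {H a ν : ℝ} {B X : ℝ≥0 → Ω → ℝ}

lemma IsFractionalBrownianMotion.ae_zero (hB : IsFractionalBrownianMotion H B μ)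
    (hH : 1 / 2 < H) : ∀ᵐ ω ∂μ, B 0 ω = 0 := by
  have h0 := hB.covariance 0 0
  rw [NNReal.coe_zero, sub_zero, abs_zero, Real.zero_rpow (by linarith)] at h0
  have h := (integral_eq_zero_iff_of_nonneg (fun ω => mul_self_nonneg _)
    ((hB.memLp 0).integrable_mul (hB.memLp 0))).1 (h0.trans (by norm_num))
  filter_upwards [h] with ω hω
  exact mul_self_eq_zero.1 hω

/-- The representation `X_t = ∫_0^t h(t, s) dB_s + ν ∫_0^t h(t, s) ds`: the same step functions
approximate both sides, almost surely on the left and in `L²` on the right. -/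
lemma exists_hasFbmIntegral_hKernel [IsProbabilityMeasure μ] (hH : 1 / 2 < H) (hH1 : H < 1)
    (ha : 0 < a) (hB : IsFractionalBrownianMotion H B μ) (hX : IsSelfAttractingDiffusion a ν B X μ) (t : ℝ≥0) :
    ∃ I : Ω → ℝ, HasFbmIntegral H B μ ((Set.Ioc (0 : ℝ) t).indicator (hKernel a t)) I ∧
      X t =ᵐ[μ] fun ω => I ω
        + ν * ∫ s in Set.Ioi (0 : ℝ), (Set.Ioc (0 : ℝ) t).indicator (hKernel a t) s := by
  have hβ := continuous_adjCoeff ha (t : ℝ)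
  have hk := continuous_derivKernel ha (t : ℝ)
  have hcont : Continuous fun s => 1 + s * adjCoeff a t s := by fun_prop
  obtain ⟨I, hI, hlim⟩ := exists_hasFbmIntegral_indicator hB hH hH1 (T := t) hcont.continuousOn
  refine ⟨I, by rwa [indicator_hKernel ha], ?_⟩
  set c := ν * ∫ s in Set.Ioi (0 : ℝ), (Set.Ioc (0 : ℝ) t).indicator (hKernel a t) s with hc
  have hstep := fun n : ℕ => (hB.memLp_stepIntegral
    (riemannStep (fun s => 1 + s * adjCoeff a t s) t n)).aestronglyMeasurable
  have hpath : ∀ᵐ ω ∂μ, Tendsto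
      (fun n : ℕ => stepIntegral B (riemannStep (fun s => 1 + s * adjCoeff a t s) t n) ω) atTop
      (𝓝 (X t ω - c)) := by
    filter_upwards [hB.ae_zero hH, hB.continuous_paths, hX.locallyIntegrable_paths, hX.equation]
      with ω hB0 hBc hXi hXe
    have hb : Continuous fun s : ℝ => B s.toNNReal ω := hBc.comp continuous_real_toNNReal
    have hsol := eq_sub_integral_derivKernel (x := fun s : ℝ => X s.toNNReal ω)
      (F := fun s : ℝ => B s.toNNReal ω + ν * s) ha t.coe_nonneg (hXi t) (by fun_prop) (by
        intro s hs
        have h := hXe s.toNNReal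
        rw [Real.coe_toNNReal s hs.1] at h
        linarith)
    have hRS := tendsto_riemannStieltjes (T := t)
      (hasDerivAt_one_add_mul_adjCoeff ha (t : ℝ)) hk hb.continuousOn
    simp only [Real.toNNReal_coe] at hsol hRS
    have hint : ∫ s in (0 : ℝ)..t, (B s.toNNReal ω + ν * s) * derivKernel a t s
        = (∫ s in (0 : ℝ)..t, B s.toNNReal ω * derivKernel a t s)
          + ν * ∫ s in (0 : ℝ)..t, s * derivKernel a t s := by
      rw [← intervalIntegral.integral_const_mul, ← intervalIntegral.integral_add
        (Continuous.intervalIntegrable (by fun_prop) _ _)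
        (Continuous.intervalIntegrable (by fun_prop) _ _)]
      exact intervalIntegral.integral_congr fun s _ => by ring
    have e : X t ω - c = (1 + t * adjCoeff a t t) * B t ω - (1 + 0 * adjCoeff a t 0)
        * B (Real.toNNReal 0) ω - ∫ s in (0 : ℝ)..t, B s.toNNReal ω * derivKernel a t s := by
      rw [Real.toNNReal_zero, hB0, adjCoeff_self, hc, ← sub_integral_mul_derivKernel ha t.coe_nonneg,
        hsol, hint]
      ring
    rw [e]
    refine hRS.congr fun n => ?_
    rw [stepIntegral_eq_linearCombination, linearCombination_riemannStep]
  have hm1 : TendstoInMeasure μ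
      (fun n : ℕ => stepIntegral B (riemannStep (fun s => 1 + s * adjCoeff a t s) t n)) atTop
      I := by
    refine tendstoInMeasure_of_tendsto_eLpNorm (p := 2) (by norm_num) hstep
      hI.memLp.aestronglyMeasurable ?_
    refine hlim.congr fun n => ?_
    rw [eLpNorm_sub_comm]
    rfl
  have hm2 : TendstoInMeasure μ
      (fun n : ℕ => stepIntegral B (riemannStep (fun s => 1 + s * adjCoeff a t s) t n)) atTop
      fun ω => X t ω - c := tendstoInMeasure_of_tendsto_ae hstep hpath
  filter_upwards [tendstoInMeasure_ae_unique hm1 hm2] with ω hω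
  rw [hω, sub_add_cancel]

end FracSelfAttracting

/-! ### Convergence and rate -/

theorem theorem3p2 {Ω : Type*} [MeasurableSpace Ω] (μ : Measure Ω) [IsProbabilityMeasure μ]
    (H a ν : ℝ) (hH : 1 / 2 < H) (hH1 : H < 1) (ha : 0 < a) (B X : ℝ≥0 → Ω → ℝ)
    (hB : FracSelfAttracting.IsFractionalBrownianMotion H B μ)
    (hX : FracSelfAttracting.IsSelfAttractingDiffusion a ν B X μ) :
    -- the two integrals that make up the limit exist
    IntegrableOn (FracSelfAttracting.hLim a) (Set.Ioi 0) ∧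
    (∃ I : Ω → ℝ, FracSelfAttracting.HasFbmIntegral H B μ (FracSelfAttracting.hLim a) I) ∧
    -- `X_t` converges to the limit in `L²(μ)`
    (∀ t : ℝ≥0, MemLp (X t) 2 μ) ∧
    (∀ I : Ω → ℝ, FracSelfAttracting.HasFbmIntegral H B μ (FracSelfAttracting.hLim a) I →
      Tendsto (fun t : ℝ≥0 =>
          eLpNorm (fun ω => X t ω
            - (I ω + ν * ∫ s in Set.Ioi (0 : ℝ), FracSelfAttracting.hLim a s)) 2 μ)
        atTop (𝓝 0)) ∧
    -- the rate for `∫_0^t (h(t, s) - h(s)) dB_s`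
    (∀ t : ℝ, 0 < t →
      (∃ J : Ω → ℝ, FracSelfAttracting.HasFbmIntegral H B μ
        ((Set.Ioc 0 t).indicator fun s =>
          FracSelfAttracting.hKernel a t s - FracSelfAttracting.hLim a s) J) ∧
      ∀ J : Ω → ℝ, FracSelfAttracting.HasFbmIntegral H B μ
        ((Set.Ioc 0 t).indicator fun s =>
          FracSelfAttracting.hKernel a t s - FracSelfAttracting.hLim a s) J →
        ∫ ω, |J ω| ^ 2 ∂μ ≤ 2 * H / (a * t ^ (2 - 2 * H))) := by
  have hh := FracSelfAttracting.isBddIntegrable_hLim ha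
  have hht := fun t : ℝ => FracSelfAttracting.isBddIntegrable_indicator_hKernel ha t
  have hrep := FracSelfAttracting.exists_hasFbmIntegral_hKernel hH hH1 ha hB hX
  refine ⟨hh.1, FracSelfAttracting.exists_hasFbmIntegral_of_continuousOn hB hH hH1 hh
    (FracSelfAttracting.continuous_hLim ha).continuousOn, fun t => ?_, fun I hI => ?_,
    fun t ht => ⟨?_, fun J hJ => ?_⟩⟩
  · obtain ⟨It, hIt, hXt⟩ := hrep t
    exact (hIt.memLp.add (memLp_const _)).ae_eq hXt.symm
  · choose It hIt hXt using hrep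
    have hcoe : Tendsto (fun t : ℝ≥0 => (t : ℝ)) atTop atTop :=
      NNReal.tendsto_coe_atTop.2 tendsto_id
    have hL1 := (FracSelfAttracting.tendsto_integral_abs_indicator_hKernel_sub_hLim ha).comp hcoe
    have hsub := fun t : ℝ≥0 => (hht t).sub hh
    have hId := fun t : ℝ≥0 => (hIt t).sub hB hH hH1 (hht t) hh hI
    have hphi : Tendsto (fun t : ℝ≥0 => FracSelfAttracting.phiNormSq H fun s =>
        (Set.Ioc (0 : ℝ) t).indicator (FracSelfAttracting.hKernel a t) s
          - FracSelfAttracting.hLim a s) atTop (𝓝 0) :=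
      FracSelfAttracting.tendsto_phiNormSq_zero hH hH1 (fun t => (hsub t).1)
        (Eventually.of_forall fun t s hs =>
          FracSelfAttracting.abs_indicator_hKernel_sub_hLim_le_one ha t hs) hL1
    have hnoise : Tendsto (fun t : ℝ≥0 => eLpNorm (fun ω => It t ω - I ω) 2 μ) atTop (𝓝 0) := by
      have h := ENNReal.tendsto_ofReal hphi.sqrt
      rw [Real.sqrt_zero, ENNReal.ofReal_zero] at h
      refine h.congr fun t => ?_
      rw [FracSelfAttracting.eLpNorm_two_eq_ofReal_sqrt (hId t).memLp,
        (hId t).integral_sq hB hH hH1 (hsub t)]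
    have hdrift : Tendsto (fun t : ℝ≥0 => eLpNorm (fun _ : Ω => ν * ∫ s in Set.Ioi (0 : ℝ),
        ((Set.Ioc (0 : ℝ) t).indicator (FracSelfAttracting.hKernel a t) s
          - FracSelfAttracting.hLim a s)) 2 μ) atTop (𝓝 0) := by
      have h1 := (squeeze_zero_norm (fun t : ℝ≥0 => abs_integral_le_integral_abs (f := fun s =>
        (Set.Ioc (0 : ℝ) t).indicator (FracSelfAttracting.hKernel a t) s
          - FracSelfAttracting.hLim a s)) hL1).const_mul ν
      rw [mul_zero] at h1
      have h2 := h1.enorm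
      rw [enorm_zero] at h2
      refine h2.congr fun t => ?_
      rw [eLpNorm_const _ two_ne_zero (IsProbabilityMeasure.ne_zero μ), measure_univ,
        ENNReal.one_rpow, mul_one]
    have hsum := hnoise.add hdrift
    rw [add_zero] at hsum
    refine tendsto_of_tendsto_of_tendsto_of_le_of_le tendsto_const_nhds hsum
      (fun t => zero_le) fun t => ?_
    refine le_trans (le_of_eq (eLpNorm_congr_ae ?_)) (eLpNorm_add_le
      (hId t).memLp.aestronglyMeasurable aestronglyMeasurable_const (by norm_num))
    filter_upwards [hXt t] with ω hω
    rw [hω, Pi.add_apply, integral_sub (hht t).1 hh.1]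
    ring
  · lift t to ℝ≥0 using ht.le
    obtain ⟨J, hJ, -⟩ := FracSelfAttracting.exists_hasFbmIntegral_indicator hB hH hH1
      (FracSelfAttracting.continuousOn_hKernel_sub_hLim ha t)
    exact ⟨J, hJ⟩
  · simp only [sq_abs]
    rw [hJ.integral_sq hB hH hH1 (FracSelfAttracting.isBddIntegrable_indicator_of_continuousOn
      (FracSelfAttracting.continuousOn_hKernel_sub_hLim ha t))]
    exact FracSelfAttracting.phiNormSq_hKernel_sub_hLim_le hH hH1 ha ht
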